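/- **Setting.** Let $N$ be even and consider $N$ qubits on a ring. Let $u=\mathrm{iSWAP}\,(H\otimes H)$ with $\mathrm{iSWAP}=\exp[\tfrac{i\pi}{4}(X\otimes X+Y\otimes Y)]$ and $H$ the Hadamard gate. One period of the dissipative Haar-doped circuit with doped set $D\subseteq\{1,\dots,N\}$, $n_h:=|D|$, consists of: the gate $u$ on all odd bonds $(1,2),(3,4),\dots$; a single-qubit unitary on each doped site; the gate $u$ on all even bonds $(2,3),\dots,(N,1)$; a second single-qubit unitary on each doped site; and finally the on-site depolarizing layer $\mathcal N$, the linear map with $\mathcal N(S)=e^{-\gamma w(S)}S$ for each Pauli string $S$, where $w(S)$ is the number of sites on which $S$ is not the identity. The single-qubit unitaries on the doped sites are an arbitrary realization of the (Haar-random) rotations. With $U$ the unitary of the first four stages, the Floquet channel is $\Phi_F(\rho)=\mathcal N(U\rho U^\dagger)$; write its eigenvalues as $e^{\lambda_a}$, with $\lambda_0=0$ for the stationary state. The Liouvillian gap (per period) is $\Delta=-\max_{a\ne0}\mathrm{Re}\,\lambda_a$. **Theorem (Necessary doping rate for finite gap).** There is a universal constant $\gamma_0>0$ such that for every fixed $\gamma\ge\gamma_0$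 (strong dissipation) the following holds. Take any sequence of such circuits with dissipation strength $\gamma$, with even sizes $N_k\to\infty$, arbitrary doped sets of sizes $n_{h,k}$, and arbitrary realizations of the single-qubit rotations, and let $\Delta_k$ be their Liouvillian gaps. 1. If the number of doped sites grows sublinearly, i.e. $n_{h,k}/N_k\to0$, then $\Delta_k\to\infty$. 2. If $\Delta_k$ stays bounded above as $k\to\infty$, then $n_{h,k}$ scales linearly with $N_k$: $n_{h,k}=\Theta(N_k)$ as $k\to\infty$. In particular, both statements hold surely when the rotations are Haar-random. -/

import Mathlib

open Filter Asymptotics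
open scoped Kronecker Topology

noncomputable section

namespace DHFC

/-- Computational basis labels of `N` qubits. -/
abbrev Config (N : ℕ) : Type := Fin N → Fin 2

/-- Operators on the Hilbert space `(ℂ²)^{⊗ N}` of `N` qubits. -/
abbrev Op (N : ℕ) : Type := Matrix (Config N) (Config N) ℂ

/-- The single-qubit Pauli matrices `σ₀ = I`, `σ₁ = X`, `σ₂ = Y`, `σ₃ = Z`. -/
def pauli : Fin 4 → Matrix (Fin 2) (Fin 2) ℂ :=
  ![1, !![0, 1; 1, 0], !![0, -Complex.I; Complex.I, 0], !![1, 0; 0, -1]]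

/-- The Hadamard gate. -/
def hadamard : Matrix (Fin 2) (Fin 2) ℂ :=
  ((Real.sqrt 2 : ℝ) : ℂ)⁻¹ • !![1, 1; 1, -1]

/-- `iSWAP = exp[i π/4 (X ⊗ X + Y ⊗ Y)]`. -/
def iSWAP : Matrix (Fin 2 × Fin 2) (Fin 2 × Fin 2) ℂ :=
  NormedSpace.exp
    ((Complex.I * Real.pi / 4) • (pauli 1 ⊗ₖ pauli 1 + pauli 2 ⊗ₖ pauli 2))

/-- The fixed two-qubit Clifford gate `u = iSWAP (H ⊗ H)`. -/
def bondGate : Matrix (Fin 2 × Fin 2) (Fin 2 × Fin 2) ℂ :=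
  iSWAP * (hadamard ⊗ₖ hadamard)

/-- The tensor product `⨂ⱼ Aⱼ` of single-qubit operators. -/
def siteProd {N : ℕ} (A : Fin N → Matrix (Fin 2) (Fin 2) ℂ) : Op N :=
  Matrix.of fun x y => ∏ j, A j (x j) (y j)

/-- One brickwork layer on the ring of `N` sites (`N` even): the tensor product of the gates `u` on
the bonds `(i, i + 1)`, with `i + 1` taken cyclically, over all sites `i` of parity `p`. Sites are
numbered from `0`, so `p = 0` gives the odd bonds `(1,2), (3,4), …` of the numbering from `1`,
and `p = 1` gives the even bonds `(2,3), …, (N,1)`. -/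
def brickLayer (N p : ℕ) : Op N :=
  Matrix.of fun x y =>
    ∏ i : Fin N with i.val % 2 = p,
      bondGate (x i, x (finRotate N i)) (y i, y (finRotate N i))

/-- The Pauli string `⨂ⱼ σ_{μⱼ}`. -/
def pauliString {N : ℕ} (μ : Fin N → Fin 4) : Op N :=
  siteProd fun j => pauli (μ j)

/-- The Pauli weight: the number of sites on which the string acts nontrivially. -/
def weight {N : ℕ} (μ : Fin N → Fin 4) : ℕ :=
  (Finset.univ.filter fun j => μ j ≠ 0).card

/-- The on-site depolarizing layer of strength `γ`: the linear map that is diagonal in the basis of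
Pauli strings, `S ↦ exp(-γ w(S)) S`. The coefficient of `S` in the Pauli expansion of `ρ` is
`tr(S ρ) / 2^N`. -/
def noise (N : ℕ) (γ : ℝ) : Op N →ₗ[ℂ] Op N where
  toFun ρ := ∑ μ : Fin N → Fin 4,
    ((Real.exp (-γ * weight μ) : ℂ) * ((pauliString μ * ρ).trace / 2 ^ N)) • pauliString μ
  map_add' ρ ρ' := by
    simp only [mul_add, Matrix.trace_add, add_div, add_smul, Finset.sum_add_distrib]
  map_smul' c ρ := by
    simp only [Matrix.mul_smul, Matrix.trace_smul, smul_eq_mul, RingHom.id_apply,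
      Finset.smul_sum, smul_smul]
    refine Finset.sum_congr rfl fun μ _ => ?_
    congr 1
    ring

/-- Pauli strings are orthogonal for the trace inner product. -/
theorem pauliString_trace_mul {N : ℕ} (μ ν : Fin N → Fin 4) :
    (pauliString μ * pauliString ν).trace = if μ = ν then 2 ^ N else 0 := by
  have h1 : (pauliString μ * pauliString ν).trace
      = ∏ j, (pauli (μ j) * pauli (ν j)).trace := by
    simp only [Matrix.trace, Matrix.diag, Matrix.mul_apply, pauliString, siteProd, Matrix.of_apply,
      ← Finset.prod_mul_distrib]
    rw [Finset.prod_univ_sum]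
    simp only [Fintype.piFinset_univ]
    refine Finset.sum_congr rfl fun x _ => ?_
    rw [Finset.prod_univ_sum]
    simp
  have h2 : ∀ a b : Fin 4, (pauli a * pauli b).trace = if a = b then 2 else 0 := by
    intro a b
    fin_cases a <;> fin_cases b <;> simp [pauli, Matrix.trace_fin_two] <;> norm_num
  rw [h1]
  simp only [h2]
  split_ifs with h
  · subst h; simp
  · obtain ⟨j, hj⟩ := Function.ne_iff.mp h
    exact Finset.prod_eq_zero (Finset.mem_univ j) (by simp [hj])

/-- The depolarizing layer multiplies each Pauli string `S` by `exp(-γ w(S))`. -/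
theorem noise_pauliString {N : ℕ} (γ : ℝ) (ν : Fin N → Fin 4) :
    noise N γ (pauliString ν) = (Real.exp (-γ * weight ν) : ℂ) • pauliString ν := by
  simp only [noise, LinearMap.coe_mk, AddHom.coe_mk, pauliString_trace_mul]
  rw [Finset.sum_eq_single ν]
  · simp
  · intro b _ hb; simp [hb]
  · simp
/-- The channel `ρ ↦ U ρ U†`. -/
def conjChannel {N : ℕ} (U : Op N) : Op N →ₗ[ℂ] Op N where
  toFun ρ := U * ρ * U.conjTranspose
  map_add' ρ ρ' := by rw [mul_add, add_mul]
  map_smul' c ρ := by simp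

/-- A realization of the Haar-doped circuit on `N` qubits: the set of doped sites, and the
single-qubit rotations applied after the first (`rot 0`) and after the second (`rot 1`) brickwork
layer. Only the rotations on doped sites are used. -/
structure Circuit (N : ℕ) where
  doped : Finset (Fin N)
  rot : Fin 2 → Fin N → Matrix.unitaryGroup (Fin 2) ℂ

namespace Circuit

variable {N : ℕ} (C : Circuit N)

/-- The number `n_h` of doped sites. -/
def numDoped : ℕ := C.doped.card

/-- The layer of single-qubit rotations on the doped sites (identity on undoped sites). -/
def rotLayer (l : Fin 2) : Op N :=
  siteProd fun j => if j ∈ C.doped then (C.rot l j : Matrix (Fin 2) (Fin 2) ℂ) else 1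

/-- The unitary of one Floquet period. -/
def periodUnitary : Op N :=
  C.rotLayer 1 * brickLayer N 1 * (C.rotLayer 0 * brickLayer N 0)

/-- The one-period Floquet channel `Φ_F`: the unitary stage followed by depolarization. -/
def floquet (γ : ℝ) : Module.End ℂ (Op N) :=
  noise N γ ∘ₗ conjChannel C.periodUnitary

/-- The Liouvillian gap per period, `Δ = - max_{a ≠ 0} Re λ_a`, where the `exp(λ_a)` are the
eigenvalues of `Φ_F` and `exp(λ_0) = 1` is the eigenvalue of the stationary state. -/
def gap (γ : ℝ) : ℝ :=
  -sSup {r : ℝ | ∃ z : ℂ, (C.floquet γ).HasEigenvalue (Complex.exp z) ∧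
    Complex.exp z ≠ 1 ∧ r = z.re}

end Circuit

end DHFC

end

/-!
The gap is bounded through trajectories of Pauli strings. Expand a traceless eigenvector of the
Floquet channel in Pauli strings. The bond gate `u` is Clifford, so a brickwork layer permutes
Pauli strings up to phases (`exists_coeff_brickLayer`). A rotation layer mixes at most `3 ^ w`
strings with the same support (`exists_coeff_siteProd`), and for strong dissipation the depolarizing
factor `exp (-γ w)` beats this multiplicity. Starting at the largest coefficient and going back
in time along the largest contributions gives a trajectory of nontrivial strings whose average
weight bounds `-log |λ|` from below (`exists_backward_path`). It remains to see that, if few sites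
are doped, the average weight along every trajectory is large, whatever happens on the doped sites.

In symplectic bits over `𝔽₂`, a trajectory is a space-time pattern obeying linear rules away from
the doped sites, while on a doped site only the support is transmitted (`IsHistory`). As the gate
is dual-unitary, the pattern can be continued in the space direction, even across doped sites, so
every site of the ring is active in every time window of length `2 N`
(`IsHistory.exists_column_ne_zero`).

Away from the doped sites the `z`-bits satisfy an eight-point relation (`IsHistory.king`). With
`S` and `Θ` the sums of the two shifts by one in space and in time, it reads `S² + SΘ + Θ² = 0`, and
factors over `𝔽₄ = 𝔽₂(ω)` as `(S + ωΘ)(S + ω²Θ) = 0`. Hence the local combination `waveField` of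
`z`-bits satisfies `S = ωΘ` (`IsHistory.wave`). In characteristic two, the same equation holds with
shifts by `2ᵏ`. Its cube, in which `ω³ = 1`, relates the two points at distance `3 · 2ᵏ` in
space to four points in time (`Wave.cubic`). The product of these relations over `r` scales relates
`2 ^ r` columns to `4 ^ r` times. If the column in the middle has few active points, there are
scales at which these do not interfere, so that all `4 ^ r` times must be active in one of
the `2 ^ r` columns (`Wave.le_sum_columnCount`). Averaging over the columns far from doped sites, the
average activity is at least of order `2 ^ r` (`IsHistory.le_sum_activity`), where `r` is
arbitrary once the density of doped sites is small enough. The degenerate columns, where the wave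
field vanishes but the `z`-bit does not, are active half of the time
(`IsHistory.le_activity_of_waveField_eq_zero`).
-/

/-! ### Bits of Pauli matrices and the bond gate -/

/-- A two-qubit operator given by its sixteen entries. -/
def ofTable (v : Fin 2 → Fin 2 → Fin 2 → Fin 2 → ℂ) :
    Matrix (Fin 2 × Fin 2) (Fin 2 × Fin 2) ℂ :=
  Matrix.of fun p q => v p.1 p.2 q.1 q.2

theorem iSWAP_eq : DHFC.iSWAP = ofTable
    ![![![![1, 0], ![0, 0]], ![![0, 0], ![Complex.I, 0]]],
      ![![![0, Complex.I], ![0, 0]], ![![0, 0], ![0, 1]]]] := by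
  -- the columns of `V` are eigenvectors of the exponent, with eigenvalues `d`
  set V : Matrix (Fin 2 × Fin 2) (Fin 2 × Fin 2) ℂ := ofTable
    ![![![![1, 0], ![0, 0]], ![![0, 1], ![1, 0]]],
      ![![![0, 1], ![-1, 0]], ![![0, 0], ![0, 1]]]] with hV
  set V' : Matrix (Fin 2 × Fin 2) (Fin 2 × Fin 2) ℂ := ofTable
    ![![![![1, 0], ![0, 0]], ![![0, 1/2], ![1/2, 0]]],
      ![![![0, 1/2], ![-1/2, 0]], ![![0, 0], ![0, 1]]]] with hV'
  set d : Fin 2 × Fin 2 → ℂ := fun p =>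
    ![![0, Complex.I * Real.pi / 2], ![-(Complex.I * Real.pi / 2), 0]] p.1 p.2 with hd
  have hVV : V * V' = 1 := by
    ext ⟨a, b⟩ ⟨c, e⟩
    fin_cases a <;> fin_cases b <;> fin_cases c <;> fin_cases e <;>
      simp [hV, hV', ofTable, Matrix.mul_apply, Fintype.sum_prod_type] <;> norm_num
  have hinv : V⁻¹ = V' := Matrix.inv_eq_right_inv hVV
  have hu : IsUnit V := IsUnit.of_mul_eq_one _ hVV
  have hA : (Complex.I * Real.pi / 4) • (DHFC.pauli 1 ⊗ₖ DHFC.pauli 1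
      + DHFC.pauli 2 ⊗ₖ DHFC.pauli 2) = V * Matrix.diagonal d * V⁻¹ := by
    rw [hinv]
    ext ⟨a, b⟩ ⟨c, e⟩
    fin_cases a <;> fin_cases b <;> fin_cases c <;> fin_cases e <;>
      simp [hV, hV', hd, ofTable, DHFC.pauli, Matrix.mul_apply, Fintype.sum_prod_type,
        Matrix.diagonal_apply] <;> ring
  have h1 : Complex.exp (Complex.I * Real.pi / 2) = Complex.I := by
    rw [show Complex.I * Real.pi / 2 = (Real.pi / 2 : ℂ) * Complex.I by ring]
    exact Complex.exp_pi_div_two_mul_I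
  have h2 : Complex.exp (-(Complex.I * Real.pi / 2)) = -Complex.I := by
    rw [Complex.exp_neg, h1, Complex.inv_I]
  rw [DHFC.iSWAP, hA, Matrix.exp_conj _ _ hu, Matrix.exp_diagonal, hinv]
  ext ⟨a, b⟩ ⟨c, e⟩
  fin_cases a <;> fin_cases b <;> fin_cases c <;> fin_cases e <;>
    simp [hV, hV', hd, ofTable, Matrix.mul_apply, Fintype.sum_prod_type,
      Matrix.diagonal_apply, Pi.coe_exp, ← Complex.exp_eq_exp_ℂ, h1, h2] <;> ring

theorem bondGate_eq : DHFC.bondGate = (1 / 2 : ℂ) • ofTable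
    ![![![![1, 1], ![1, 1]],
        ![![Complex.I, Complex.I], ![-Complex.I, -Complex.I]]],
      ![![![Complex.I, -Complex.I], ![Complex.I, -Complex.I]],
        ![![1, -1], ![-1, 1]]]] := by
  have h : DHFC.hadamard ⊗ₖ DHFC.hadamard
      = (1 / 2 : ℂ) • ((!![1, 1; 1, -1] : Matrix (Fin 2) (Fin 2) ℂ) ⊗ₖ !![1, 1; 1, -1]) := by
    have h2 : (((Real.sqrt 2 : ℝ) : ℂ)⁻¹) * (((Real.sqrt 2 : ℝ) : ℂ)⁻¹) = 1 / 2 := by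
      rw [← mul_inv, ← Complex.ofReal_mul, Real.mul_self_sqrt (by norm_num)]
      norm_num
    rw [DHFC.hadamard, Matrix.smul_kronecker, Matrix.kronecker_smul, smul_smul, h2]
  rw [DHFC.bondGate, iSWAP_eq, h, Matrix.mul_smul]
  congr 1
  ext ⟨a, b⟩ ⟨c, e⟩
  fin_cases a <;> fin_cases b <;> fin_cases c <;> fin_cases e <;>
    simp [ofTable, Matrix.mul_apply, Fintype.sum_prod_type]

theorem bondGate_conjTranspose_mul : DHFC.bondGate.conjTranspose * DHFC.bondGate = 1 := by
  rw [bondGate_eq]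
  ext ⟨a, b⟩ ⟨c, e⟩
  fin_cases a <;> fin_cases b <;> fin_cases c <;> fin_cases e <;>
    simp [ofTable, Matrix.mul_apply, Fintype.sum_prod_type, Matrix.conjTranspose_apply] <;>
    norm_num <;> ring_nf <;> simp <;> norm_num

/-- The symplectic bits `(x, z)` of a Pauli matrix, which is `X ^ x * Z ^ z` up to a phase. -/
def bits : Fin 4 → ZMod 2 × ZMod 2 := ![(0, 0), (1, 0), (1, 1), (0, 1)]

/-- The left-hand output of the gate `u` on Pauli bits `a` (left) and `b` (right). -/
def outL (a b : ZMod 2 × ZMod 2) : ZMod 2 × ZMod 2 := (b.2, a.2 + b.1 + b.2)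

/-- The right-hand output of the gate `u` on Pauli bits `a` (left) and `b` (right). -/
def outR (a b : ZMod 2 × ZMod 2) : ZMod 2 × ZMod 2 := (a.2, a.1 + a.2 + b.2)

theorem bits_injective : Function.Injective bits := by decide

theorem bits_eq_zero {a : Fin 4} : bits a = 0 ↔ a = 0 := by
  revert a; decide

/-- The Pauli matrix with given bits. -/
def ofBits (v : ZMod 2 × ZMod 2) : Fin 4 := if v.1 = 0 then (if v.2 = 0 then 0 else 3) else
  (if v.2 = 0 then 1 else 2)

theorem bits_ofBits (v : ZMod 2 × ZMod 2) : bits (ofBits v) = v := by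
  revert v; decide

/-- The Pauli matrices over the Gaussian integers, where identities between them can be decided. -/
def pauliInt : Fin 4 → Fin 2 → Fin 2 → GaussianInt :=
  ![![![1, 0], ![0, 1]], ![![0, 1], ![1, 0]], ![![0, ⟨0, -1⟩], ![⟨0, 1⟩, 0]],
    ![![1, 0], ![0, -1]]]

/-- Twice the gate `u`, over the Gaussian integers. -/
def bondInt : Fin 2 → Fin 2 → Fin 2 → Fin 2 → GaussianInt :=
  ![![![![1, 1], ![1, 1]], ![![⟨0, 1⟩, ⟨0, 1⟩], ![⟨0, -1⟩, ⟨0, -1⟩]]],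
    ![![![⟨0, 1⟩, ⟨0, -1⟩], ![⟨0, 1⟩, ⟨0, -1⟩]], ![![1, -1], ![-1, 1]]]]

theorem pauli_eq_pauliInt (a : Fin 4) (i j : Fin 2) :
    DHFC.pauli a i j = GaussianInt.toComplex (pauliInt a i j) := by
  fin_cases a <;> fin_cases i <;> fin_cases j <;>
    simp [DHFC.pauli, pauliInt, GaussianInt.toComplex_def]

theorem bondGate_eq_bondInt (p q : Fin 2 × Fin 2) :
    DHFC.bondGate p q = 1 / 2 * GaussianInt.toComplex (bondInt p.1 p.2 q.1 q.2) := by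
  obtain ⟨a, b⟩ := p
  obtain ⟨c, e⟩ := q
  rw [bondGate_eq]
  fin_cases a <;> fin_cases b <;> fin_cases c <;> fin_cases e <;>
    simp [ofTable, bondInt, GaussianInt.toComplex_def]

theorem bondInt_pauliInt (a b : Fin 4) (i j k l : Fin 2) :
    ∑ m, ∑ n, pauliInt (ofBits (outL (bits a) (bits b))) i m
        * pauliInt (ofBits (outR (bits a) (bits b))) j n * bondInt m n k l
      = (if (a = 2 ∧ b = 3) ∨ (a = 3 ∧ b = 2) then -1 else 1)
        * ∑ m, ∑ n, bondInt i j m n * (pauliInt a m k * pauliInt b n l) := by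
  revert a b i j k l
  decide +kernel

/-- The gate `u` is Clifford: conjugation by it permutes two-qubit Pauli strings up to phases, and
acts on their bits by `outL` and `outR`. -/
theorem bondGate_pauli (a b : Fin 4) : ∃ ε : ℂ, ‖ε‖ = 1 ∧
    (DHFC.pauli (ofBits (outL (bits a) (bits b))) ⊗ₖ DHFC.pauli (ofBits (outR (bits a) (bits b))))
      * DHFC.bondGate
      = ε • (DHFC.bondGate * (DHFC.pauli a ⊗ₖ DHFC.pauli b)) := by
  refine ⟨GaussianInt.toComplex (if (a = 2 ∧ b = 3) ∨ (a = 3 ∧ b = 2) then -1 else 1),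
    by split_ifs <;> simp, ?_⟩
  ext ⟨i, j⟩ ⟨k, l⟩
  have h := congrArg GaussianInt.toComplex (bondInt_pauliInt a b i j k l)
  simp only [map_mul, map_sum] at h
  simp only [Matrix.mul_apply, Matrix.smul_apply, smul_eq_mul, Matrix.kroneckerMap_apply,
    Fintype.sum_prod_type, bondGate_eq_bondInt, pauli_eq_pauliInt]
  have e1 : ∀ x y z : ℂ, x * y * (1 / 2 * z) = 1 / 2 * (x * y * z) := fun x y z => by ring
  have e2 : ∀ x y : ℂ, 1 / 2 * x * y = 1 / 2 * (x * y) := fun x y => by ring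
  simp only [e1, e2, ← Finset.mul_sum]
  rw [h]
  ring

/-! ### Product operators and brickwork layers -/

theorem siteProd_mul {N : ℕ} (A B : Fin N → Matrix (Fin 2) (Fin 2) ℂ) :
    DHFC.siteProd A * DHFC.siteProd B = DHFC.siteProd fun j => A j * B j := by
  ext x z
  simp only [DHFC.siteProd, Matrix.mul_apply, Matrix.of_apply, ← Finset.prod_mul_distrib]
  rw [Finset.prod_univ_sum, Fintype.piFinset_univ]

theorem siteProd_one {N : ℕ} :
    DHFC.siteProd (fun _ : Fin N => (1 : Matrix (Fin 2) (Fin 2) ℂ)) = 1 := by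
  ext x y
  simp only [DHFC.siteProd, Matrix.of_apply, Matrix.one_apply, Finset.prod_ite_zero,
    Finset.prod_const_one, Finset.mem_univ, forall_true_left, funext_iff]

theorem siteProd_conjTranspose {N : ℕ} (A : Fin N → Matrix (Fin 2) (Fin 2) ℂ) :
    (DHFC.siteProd A).conjTranspose = DHFC.siteProd fun j => (A j).conjTranspose := by
  ext x y
  simp [DHFC.siteProd, Matrix.conjTranspose_apply]

theorem siteProd_sum_smul {N : ℕ} (c : Fin N → Fin 4 → ℂ) :
    DHFC.siteProd (fun j => ∑ a, c j a • DHFC.pauli a)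
      = ∑ α : Fin N → Fin 4, (∏ j, c j (α j)) • DHFC.pauliString α := by
  ext x y
  simp only [DHFC.siteProd, DHFC.pauliString, Matrix.of_apply, Matrix.sum_apply,
    Matrix.smul_apply, smul_eq_mul, ← Finset.prod_mul_distrib]
  rw [Finset.prod_univ_sum, Fintype.piFinset_univ]

/-- The tensor product of two-qubit operators over a pairing `e` of the sites. -/
def pairProd {N : ℕ} {β : Type} [Fintype β] (e : β × Fin 2 ≃ Fin N)
    (M : β → Matrix (Fin 2 × Fin 2) (Fin 2 × Fin 2) ℂ) : DHFC.Op N :=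
  Matrix.of fun x y => ∏ b, M b (x (e (b, 0)), x (e (b, 1))) (y (e (b, 0)), y (e (b, 1)))

section PairProd

variable {N : ℕ} {β : Type} [Fintype β] (e : β × Fin 2 ≃ Fin N)

theorem sum_config_prod_pairs [DecidableEq β] (f : β → Fin 2 × Fin 2 → ℂ) :
    ∑ y : DHFC.Config N, ∏ b, f b (y (e (b, 0)), y (e (b, 1))) = ∏ b, ∑ v, f b v := by
  rw [Finset.prod_univ_sum, Fintype.piFinset_univ]
  let E : DHFC.Config N ≃ (β → Fin 2 × Fin 2) :=
    ((e.arrowCongr (Equiv.refl (Fin 2))).symm.trans (Equiv.curry β (Fin 2) (Fin 2))).trans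
      ((Equiv.refl β).arrowCongr (finTwoArrowEquiv (Fin 2)))
  exact Fintype.sum_equiv E _ _ fun y => rfl

theorem pairProd_mul (M M' : β → Matrix (Fin 2 × Fin 2) (Fin 2 × Fin 2) ℂ) :
    pairProd e M * pairProd e M' = pairProd e fun b => M b * M' b := by
  classical
  ext x z
  simp only [pairProd, Matrix.mul_apply, Matrix.of_apply, ← Finset.prod_mul_distrib]
  exact sum_config_prod_pairs e fun b v =>
    M b (x (e (b, 0)), x (e (b, 1))) v * M' b v (z (e (b, 0)), z (e (b, 1)))

theorem siteProd_eq_pairProd (A : Fin N → Matrix (Fin 2) (Fin 2) ℂ) :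
    DHFC.siteProd A = pairProd e fun b => A (e (b, 0)) ⊗ₖ A (e (b, 1)) := by
  ext x y
  simp only [DHFC.siteProd, pairProd, Matrix.of_apply, Matrix.kroneckerMap_apply]
  rw [← Equiv.prod_comp e, Fintype.prod_prod_type]
  simp [Fin.prod_univ_two]

theorem pairProd_one : pairProd e (fun _ => 1) = 1 := by
  rw [← siteProd_one, siteProd_eq_pairProd e]
  simp

theorem pairProd_conjTranspose (M : β → Matrix (Fin 2 × Fin 2) (Fin 2 × Fin 2) ℂ) :
    (pairProd e M).conjTranspose = pairProd e fun b => (M b).conjTranspose := by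
  ext x y
  simp [pairProd, Matrix.conjTranspose_apply]

theorem pairProd_smul (ε : β → ℂ) (M : β → Matrix (Fin 2 × Fin 2) (Fin 2 × Fin 2) ℂ) :
    pairProd e (fun b => ε b • M b) = (∏ b, ε b) • pairProd e M := by
  ext x y
  simp [pairProd, Finset.prod_mul_distrib]

end PairProd

theorem val_finRotate_mod_two {N : ℕ} (hN : Even N) (i : Fin N) :
    (finRotate N i).val % 2 = (i.val + 1) % 2 := by
  obtain _ | n := N
  · exact i.elim0
  obtain ⟨k, hk⟩ := hN
  rw [coe_finRotate]
  split_ifs with h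
  · rw [h, Fin.val_last]; omega
  · rfl

/-- The pairing of the sites of an even ring into the bonds `(i, i + 1)` with `i` of parity `p`. -/
noncomputable def bondEquiv {N : ℕ} (hN : Even N) (p : ℕ) (hp : p < 2) :
    {i : Fin N // i.val % 2 = p} × Fin 2 ≃ Fin N :=
  Equiv.ofBijective (fun b => if b.2 = 0 then b.1.1 else finRotate N b.1.1) <| by
    constructor
    · rintro ⟨⟨i, hi⟩, a⟩ ⟨⟨j, hj⟩, b⟩ h
      have h1 := val_finRotate_mod_two hN i
      have h2 := val_finRotate_mod_two hN j
      fin_cases a <;> fin_cases b <;> simp [-finRotate_apply] at h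
      · simp [h]
      · rw [h] at hi; omega
      · rw [← h] at hj; omega
      · simp [h]
    · intro j
      by_cases hj : j.val % 2 = p
      · exact ⟨(⟨j, hj⟩, 0), by simp⟩
      · have h1 := val_finRotate_mod_two hN ((finRotate N).symm j)
        rw [Equiv.apply_symm_apply] at h1
        exact ⟨(⟨(finRotate N).symm j, by omega⟩, 1), by
          simp [-finRotate_apply, -finRotate_symm_apply]⟩

section Brick

variable {N : ℕ} (hN : Even N) (p : ℕ) (hp : p < 2)

theorem bondEquiv_zero (i : {i : Fin N // i.val % 2 = p}) : bondEquiv hN p hp (i, 0) = i := by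
  simp [bondEquiv]

theorem bondEquiv_one (i : {i : Fin N // i.val % 2 = p}) :
    bondEquiv hN p hp (i, 1) = finRotate N i := rfl

theorem brickLayer_eq_pairProd :
    DHFC.brickLayer N p = pairProd (bondEquiv hN p hp) fun _ => DHFC.bondGate := by
  ext x y
  simp only [DHFC.brickLayer, pairProd, Matrix.of_apply, bondEquiv_zero, bondEquiv_one]
  exact Finset.prod_subtype _ (by simp) _

include hN hp in
theorem brickLayer_conjTranspose_mul :
    (DHFC.brickLayer N p).conjTranspose * DHFC.brickLayer N p = 1 := by
  rw [brickLayer_eq_pairProd hN p hp, pairProd_conjTranspose, pairProd_mul]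
  simp only [bondGate_conjTranspose_mul, pairProd_one]
end Brick

/-- The coefficient of a Pauli string in an operator, up to the factor `2 ^ N`. -/
noncomputable def coeff {N : ℕ} (μ : Fin N → Fin 4) (ρ : DHFC.Op N) : ℂ :=
  (DHFC.pauliString μ * ρ).trace

/-- A brickwork layer is Clifford: it maps a Pauli string `μ` to a Pauli string `ν`, up to a phase,
by the action of the gate on bits. Every `ν` arises, so the layer transports coefficients. -/
theorem exists_coeff_brickLayer {N : ℕ} (hN : Even N) (p : ℕ) (hp : p < 2) (ν : Fin N → Fin 4) :
    ∃ μ : Fin N → Fin 4,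
      (∀ i : Fin N, i.val % 2 = p →
        bits (ν i) = outL (bits (μ i)) (bits (μ (finRotate N i))) ∧
        bits (ν (finRotate N i)) = outR (bits (μ i)) (bits (μ (finRotate N i)))) ∧
      ∀ ρ : DHFC.Op N, ‖coeff ν (DHFC.conjChannel (DHFC.brickLayer N p) ρ)‖ = ‖coeff μ ρ‖ := by
  set e := bondEquiv hN p hp with he
  -- the inverse of the action of the gate on bits
  let inL : ZMod 2 × ZMod 2 → ZMod 2 × ZMod 2 → ZMod 2 × ZMod 2 := fun a b =>
    (b.2 + b.1 + a.1, b.1)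
  let inR : ZMod 2 × ZMod 2 → ZMod 2 × ZMod 2 → ZMod 2 × ZMod 2 := fun a b =>
    (a.2 + b.1 + a.1, a.1)
  have hinL : ∀ a b, outL (inL a b) (inR a b) = a := by decide
  have hinR : ∀ a b, outR (inL a b) (inR a b) = b := by decide
  let μ : Fin N → Fin 4 := fun j =>
    ofBits ((if (e.symm j).2 = 0 then inL else inR)
      (bits (ν (e ((e.symm j).1, 0)))) (bits (ν (e ((e.symm j).1, 1)))))
  have hμ0 : ∀ b, bits (μ (e (b, 0))) = inL (bits (ν (e (b, 0)))) (bits (ν (e (b, 1)))) := by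
    intro b; simp [μ, bits_ofBits]
  have hμ1 : ∀ b, bits (μ (e (b, 1))) = inR (bits (ν (e (b, 0)))) (bits (ν (e (b, 1)))) := by
    intro b; simp [μ, bits_ofBits]
  have hν0 : ∀ b, bits (ν (e (b, 0))) = outL (bits (μ (e (b, 0)))) (bits (μ (e (b, 1)))) := by
    intro b; rw [hμ0, hμ1, hinL]
  have hν1 : ∀ b, bits (ν (e (b, 1))) = outR (bits (μ (e (b, 0)))) (bits (μ (e (b, 1)))) := by
    intro b; rw [hμ0, hμ1, hinR]
  refine ⟨μ, fun i hi => ?_, fun ρ => ?_⟩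
  · have h0 := hν0 ⟨i, hi⟩
    have h1 := hν1 ⟨i, hi⟩
    simp only [he, bondEquiv_zero, bondEquiv_one] at h0 h1
    exact ⟨h0, h1⟩
  have hbits : ∀ a, ofBits (bits a) = a := fun a => bits_injective (bits_ofBits _)
  choose ε hε hcomm using fun b => bondGate_pauli (μ (e (b, 0))) (μ (e (b, 1)))
  have key : DHFC.pauliString ν * DHFC.brickLayer N p
      = (∏ b, ε b) • (DHFC.brickLayer N p * DHFC.pauliString μ) := by
    rw [DHFC.pauliString, DHFC.pauliString, siteProd_eq_pairProd e, siteProd_eq_pairProd e,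
      brickLayer_eq_pairProd hN p hp, pairProd_mul, pairProd_mul, ← pairProd_smul]
    congr 1
    funext b
    rw [← hcomm b, ← hν0, ← hν1, hbits, hbits]
  have hB := brickLayer_conjTranspose_mul hN p hp
  have : coeff ν (DHFC.conjChannel (DHFC.brickLayer N p) ρ) = (∏ b, ε b) * coeff μ ρ := by
    simp only [coeff, DHFC.conjChannel, LinearMap.coe_mk, AddHom.coe_mk]
    rw [← mul_assoc, ← mul_assoc, key, Matrix.trace_mul_comm, Matrix.smul_mul, Matrix.mul_smul,
      mul_assoc, ← mul_assoc, hB, one_mul, Matrix.trace_smul, smul_eq_mul]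
  rw [this, norm_mul, norm_prod]
  simp [hε]

/-! ### Layers of single-qubit rotations -/

theorem exists_norm_sum_le {ι : Type*} [Fintype ι] (k r : ι → ℂ) (C : ℝ)
    (hC : ∑ i, ‖k i‖ ≤ C) (h : ∑ i, k i * r i ≠ 0) :
    ∃ i, k i ≠ 0 ∧ ‖∑ i, k i * r i‖ ≤ C * ‖r i‖ := by
  classical
  have hne : (Finset.univ.filter fun i => k i ≠ 0).Nonempty := by
    by_contra hcon
    rw [Finset.not_nonempty_iff_eq_empty, Finset.filter_eq_empty_iff] at hcon
    exact h (Finset.sum_eq_zero fun i hi => by simp [not_not.mp (hcon hi)])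
  obtain ⟨i, hi, hmax⟩ := Finset.exists_max_image _ (fun i => ‖r i‖) hne
  refine ⟨i, (Finset.mem_filter.mp hi).2, ?_⟩
  calc ‖∑ i, k i * r i‖ ≤ ∑ j, ‖k j‖ * ‖r j‖ := by
        refine (norm_sum_le _ _).trans (Finset.sum_le_sum fun j _ => by rw [norm_mul])
    _ ≤ ∑ j, ‖k j‖ * ‖r i‖ := by
        refine Finset.sum_le_sum fun j _ => ?_
        by_cases hj : k j = 0
        · simp [hj]
        · exact mul_le_mul_of_nonneg_left (hmax j (by simp [hj])) (norm_nonneg _)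
    _ = (∑ j, ‖k j‖) * ‖r i‖ := by rw [Finset.sum_mul]
    _ ≤ C * ‖r i‖ := mul_le_mul_of_nonneg_right hC (norm_nonneg _)

theorem eq_sum_pauli (M : Matrix (Fin 2) (Fin 2) ℂ) :
    M = ∑ a, ((DHFC.pauli a * M).trace / 2) • DHFC.pauli a := by
  ext i j
  fin_cases i <;> fin_cases j <;>
    simp [Fin.sum_univ_four, DHFC.pauli, Matrix.trace_fin_two, Matrix.mul_apply] <;>
    ring_nf <;> simp <;> ring

theorem pauli_mem_unitary (a : Fin 4) : DHFC.pauli a ∈ Matrix.unitaryGroup (Fin 2) ℂ := by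
  rw [Matrix.mem_unitaryGroup_iff]
  fin_cases a <;> ext i j <;> fin_cases i <;> fin_cases j <;>
    simp [DHFC.pauli, Matrix.mul_apply, Matrix.star_apply]

/-- The matrix entries of conjugation by `A` on the Pauli basis of one qubit. -/
noncomputable def rotCoeff (A : Matrix (Fin 2) (Fin 2) ℂ) (b a : Fin 4) : ℂ :=
  (DHFC.pauli a * (A.conjTranspose * DHFC.pauli b * A)).trace / 2

section Rot

variable {A : Matrix (Fin 2) (Fin 2) ℂ} (hA : A ∈ Matrix.unitaryGroup (Fin 2) ℂ)
include hA

theorem trace_conj_pauli (b : Fin 4) :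
    (A.conjTranspose * DHFC.pauli b * A).trace = if b = 0 then 2 else 0 := by
  rw [Matrix.trace_mul_comm, ← mul_assoc]
  have h : A * A.conjTranspose = 1 := Matrix.mem_unitaryGroup_iff.mp hA
  rw [h, one_mul]
  fin_cases b <;> simp [DHFC.pauli, Matrix.trace_fin_two]

theorem rotCoeff_zero_left (a : Fin 4) : rotCoeff A 0 a = if a = 0 then 1 else 0 := by
  have h : A.conjTranspose * A = 1 := Matrix.mem_unitaryGroup_iff'.mp hA
  have h0 : DHFC.pauli 0 = 1 := rfl
  rw [rotCoeff, h0, mul_one, h, mul_one]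
  fin_cases a <;> simp [DHFC.pauli, Matrix.trace_fin_two]

theorem rotCoeff_zero_right (b : Fin 4) : rotCoeff A b 0 = if b = 0 then 1 else 0 := by
  have h0 : DHFC.pauli 0 = 1 := rfl
  rw [rotCoeff, h0, one_mul, trace_conj_pauli hA]
  split_ifs <;> norm_num

theorem norm_rotCoeff_le (b a : Fin 4) : ‖rotCoeff A b a‖ ≤ 1 := by
  have hM : DHFC.pauli a * (A.conjTranspose * DHFC.pauli b * A)
      ∈ Matrix.unitaryGroup (Fin 2) ℂ :=
    mul_mem (pauli_mem_unitary a)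
      (mul_mem (mul_mem (Unitary.star_mem hA) (pauli_mem_unitary b)) hA)
  have h0 := entry_norm_bound_of_unitary hM 0 0
  have h1 := entry_norm_bound_of_unitary hM 1 1
  rw [rotCoeff, Matrix.trace_fin_two, norm_div, Complex.norm_ofNat,
    div_le_one (by norm_num)]
  exact (norm_add_le _ _).trans (by linarith)

theorem sum_norm_rotCoeff_le (b : Fin 4) :
    ∑ a, ‖rotCoeff A b a‖ ≤ if b ≠ 0 then 3 else 1 := by
  split_ifs with hb
  · rw [Fin.sum_univ_four, rotCoeff_zero_right hA, if_neg hb, norm_zero]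
    linarith [norm_rotCoeff_le hA b 1, norm_rotCoeff_le hA b 2, norm_rotCoeff_le hA b 3]
  · rw [not_not] at hb
    subst hb
    simp [rotCoeff_zero_left hA, Fin.sum_univ_four]

end Rot

theorem rotCoeff_one (b a : Fin 4) : rotCoeff 1 b a = if a = b then 1 else 0 := by
  rw [rotCoeff, Matrix.conjTranspose_one, one_mul, mul_one]
  fin_cases a <;> fin_cases b <;> simp [DHFC.pauli, Matrix.trace_fin_two]

/-- A layer of single-qubit unitaries preserves the support of Pauli strings, and fixes them on the
sites where it is the identity. As at most `3 ^ w` strings have a given support of size `w`, one of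
those contributing to a coefficient is at most that factor smaller. -/
theorem exists_coeff_siteProd {N : ℕ} (A : Fin N → Matrix (Fin 2) (Fin 2) ℂ)
    (hA : ∀ j, A j ∈ Matrix.unitaryGroup (Fin 2) ℂ) (ν : Fin N → Fin 4) (ρ : DHFC.Op N)
    (h : coeff ν (DHFC.conjChannel (DHFC.siteProd A) ρ) ≠ 0) :
    ∃ μ : Fin N → Fin 4, (∀ j, μ j = 0 ↔ ν j = 0) ∧ (∀ j, A j = 1 → μ j = ν j) ∧
      ‖coeff ν (DHFC.conjChannel (DHFC.siteProd A) ρ)‖ ≤ 3 ^ DHFC.weight ν * ‖coeff μ ρ‖ := by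
  have hexp : coeff ν (DHFC.conjChannel (DHFC.siteProd A) ρ)
      = ∑ μ, (∏ j, rotCoeff (A j) (ν j) (μ j)) * coeff μ ρ := by
    have h1 : (DHFC.siteProd A).conjTranspose * DHFC.pauliString ν * DHFC.siteProd A
        = ∑ μ, (∏ j, rotCoeff (A j) (ν j) (μ j)) • DHFC.pauliString μ := by
      rw [siteProd_conjTranspose, DHFC.pauliString, siteProd_mul, siteProd_mul,
        ← siteProd_sum_smul fun j a => rotCoeff (A j) (ν j) a]
      congr 1
      funext j
      exact eq_sum_pauli _
    simp only [coeff, DHFC.conjChannel, LinearMap.coe_mk, AddHom.coe_mk]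
    rw [← mul_assoc, ← mul_assoc, Matrix.trace_mul_comm, ← mul_assoc, ← mul_assoc, h1,
      Finset.sum_mul, Matrix.trace_sum]
    simp
  have hsum : ∑ μ : Fin N → Fin 4, ‖∏ j, rotCoeff (A j) (ν j) (μ j)‖ ≤ 3 ^ DHFC.weight ν := by
    simp only [norm_prod]
    rw [← Fintype.piFinset_univ, ← Finset.prod_univ_sum (fun _ => Finset.univ)
      (fun j a => ‖rotCoeff (A j) (ν j) a‖)]
    calc ∏ j, ∑ a, ‖rotCoeff (A j) (ν j) a‖ ≤ ∏ j, if ν j ≠ 0 then (3 : ℝ) else 1 :=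
          Finset.prod_le_prod (fun j _ => Finset.sum_nonneg fun a _ => norm_nonneg _)
            fun j _ => sum_norm_rotCoeff_le (hA j) _
      _ = 3 ^ DHFC.weight ν := by
          rw [← Finset.prod_filter, Finset.prod_const, DHFC.weight]
  rw [hexp] at h ⊢
  obtain ⟨μ, hμ, hle⟩ := exists_norm_sum_le _ _ _ hsum h
  rw [Finset.prod_ne_zero_iff] at hμ
  refine ⟨μ, fun j => ?_, fun j hj => ?_, hle⟩
  · have hj := hμ j (Finset.mem_univ j)
    constructor <;> intro h0 <;> by_contra h1
    · rw [h0, rotCoeff_zero_right (hA j), if_neg h1] at hj; exact hj rfl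
    · rw [h0, rotCoeff_zero_left (hA j), if_neg h1] at hj; exact hj rfl
  · have hj' := hμ j (Finset.mem_univ j)
    rw [hj, rotCoeff_one] at hj'
    by_contra h1
    exact hj' (if_neg h1)

/-! ### Trajectories of Pauli strings -/

/-- The action of a brickwork layer on Pauli strings, phases being dropped: on every bond
`(i, i + 1)` with `i` of parity `p`, the string `μ` is sent to `ν` by the gate. -/
def BrickRel {N : ℕ} (p : ℕ) (μ ν : Fin N → Fin 4) : Prop :=
  ∀ i : Fin N, i.val % 2 = p →
    bits (ν i) = outL (bits (μ i)) (bits (μ (finRotate N i))) ∧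
    bits (ν (finRotate N i)) = outR (bits (μ i)) (bits (μ (finRotate N i)))

/-- A transition between Pauli strings with nonzero amplitude in a brickwork layer followed by
arbitrary rotations on the sites of `D`. -/
def HalfStep {N : ℕ} (D : Finset (Fin N)) (p : ℕ) (μ ν : Fin N → Fin 4) : Prop :=
  ∃ α : Fin N → Fin 4, BrickRel p μ α ∧ (∀ j, α j = 0 ↔ ν j = 0) ∧ ∀ j ∉ D, α j = ν j

theorem out_eq_zero {a b : ZMod 2 × ZMod 2} (hl : outL a b = 0) (hr : outR a b = 0) :
    a = 0 ∧ b = 0 := by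
  revert a b; decide

/-- A gate can at most halve the weight on its bond, as it has no trivial output on a nontrivial
input. -/
theorem HalfStep.weight_le {N : ℕ} (hN : Even N) {D : Finset (Fin N)} {p : ℕ} (hp : p < 2)
    {μ ν : Fin N → Fin 4} (h : HalfStep D p μ ν) : DHFC.weight μ ≤ 2 * DHFC.weight ν := by
  classical
  obtain ⟨α, hb, h0, -⟩ := h
  -- the other site of the bond
  let π : Fin N → Fin N := fun j => if j.val % 2 = p then finRotate N j else (finRotate N).symm j
  have hcase : ∀ i : Fin N, i.val % 2 = p → ν i = 0 → ν (finRotate N i) = 0 →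
      μ i = 0 ∧ μ (finRotate N i) = 0 := by
    intro i hi h1 h2
    have h3 := hb i hi
    rw [(h0 _).mpr h1, (h0 _).mpr h2, bits_eq_zero.mpr rfl] at h3
    have h4 := out_eq_zero h3.1.symm h3.2.symm
    exact ⟨bits_eq_zero.mp h4.1, bits_eq_zero.mp h4.2⟩
  have hsub : (Finset.univ.filter fun j => μ j ≠ 0) ⊆
      (Finset.univ.filter fun j => ν j ≠ 0) ∪ (Finset.univ.filter fun j => ν j ≠ 0).image π := by
    intro j hj
    simp only [Finset.mem_filter, Finset.mem_univ, true_and, Finset.mem_union,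
      Finset.mem_image] at hj ⊢
    by_contra! hcon
    obtain ⟨h1, h2⟩ := hcon
    have h3 := val_finRotate_mod_two hN j
    by_cases hjp : j.val % 2 = p
    · refine hj (hcase j hjp h1 ?_).1
      by_contra h4
      refine h2 _ h4 ?_
      simp only [π]
      rw [if_neg (by omega), Equiv.symm_apply_apply]
    · have h5 := val_finRotate_mod_two hN ((finRotate N).symm j)
      rw [Equiv.apply_symm_apply] at h5
      have h6 := hcase ((finRotate N).symm j) (by omega)
      rw [Equiv.apply_symm_apply] at h6
      refine hj (h6 ?_ h1).2
      by_contra h4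
      refine h2 _ h4 ?_
      simp only [π]
      rw [if_pos (by omega), Equiv.apply_symm_apply]
  have h1 := Finset.card_le_card hsub
  have h2 := Finset.card_union_le (Finset.univ.filter fun j => ν j ≠ 0)
    ((Finset.univ.filter fun j => ν j ≠ 0).image π)
  have h3 := Finset.card_image_le (s := Finset.univ.filter fun j => ν j ≠ 0) (f := π)
  simp only [DHFC.weight]
  omega

theorem conjChannel_mul {N : ℕ} (U V ρ : DHFC.Op N) :
    DHFC.conjChannel (U * V) ρ = DHFC.conjChannel U (DHFC.conjChannel V ρ) := by
  simp [DHFC.conjChannel, Matrix.conjTranspose_mul, mul_assoc]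

theorem coeff_noise {N : ℕ} (γ : ℝ) (ν : Fin N → Fin 4) (ρ : DHFC.Op N) :
    coeff ν (DHFC.noise N γ ρ) = (Real.exp (-γ * DHFC.weight ν) : ℂ) * coeff ν ρ := by
  simp only [coeff, DHFC.noise, LinearMap.coe_mk, AddHom.coe_mk, Finset.mul_sum,
    Matrix.trace_sum, Matrix.mul_smul, Matrix.trace_smul, DHFC.pauliString_trace_mul, smul_eq_mul]
  rw [Finset.sum_eq_single ν]
  · simp; field_simp
  · intro b _ hb; simp [hb.symm]
  · simp

section Floquet

variable {N : ℕ} (hN : Even N) (C : DHFC.Circuit N)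

theorem rotLayer_mem_unitary (l : Fin 2) (j : Fin N) :
    (if j ∈ C.doped then (C.rot l j : Matrix (Fin 2) (Fin 2) ℂ) else 1)
      ∈ Matrix.unitaryGroup (Fin 2) ℂ := by
  split_ifs
  · exact (C.rot l j).2
  · exact one_mem _

theorem rotLayer_conjTranspose_mul (l : Fin 2) :
    (C.rotLayer l).conjTranspose * C.rotLayer l = 1 := by
  rw [DHFC.Circuit.rotLayer, siteProd_conjTranspose, siteProd_mul, ← siteProd_one]
  congr 1
  funext j
  exact Matrix.mem_unitaryGroup_iff'.mp (rotLayer_mem_unitary C l j)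

/-- Nonzero eigenvalues have eigenvectors in the range of `noise`, a span of Pauli strings. -/
theorem exists_coeff_ne_zero {γ : ℝ} {lam : ℂ} {ρ : DHFC.Op N} (hρ : C.floquet γ ρ = lam • ρ) (hlam : lam ≠ 0) (h : ρ ≠ 0) :
    ∃ ν, coeff ν ρ ≠ 0 := by
  by_contra! hcon
  have h1 : ∀ ν, coeff ν (DHFC.conjChannel C.periodUnitary ρ) = 0 := by
    intro ν
    have h2 : lam * coeff ν ρ
        = (Real.exp (-γ * DHFC.weight ν) : ℂ) * coeff ν (DHFC.conjChannel C.periodUnitary ρ) := by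
      rw [← coeff_noise, ← LinearMap.comp_apply, ← DHFC.Circuit.floquet, hρ]
      simp [coeff]
    rw [hcon, mul_zero, eq_comm, mul_eq_zero] at h2
    exact h2.resolve_left (by exact_mod_cast (Real.exp_pos _).ne')
  apply h
  have h3 : lam • ρ = 0 := by
    rw [← hρ, DHFC.Circuit.floquet, LinearMap.comp_apply, DHFC.noise]
    simp only [LinearMap.coe_mk, AddHom.coe_mk]
    refine Finset.sum_eq_zero fun μ _ => ?_
    have h4 := h1 μ
    rw [coeff] at h4
    rw [h4]
    simp
  exact (smul_eq_zero.mp h3).resolve_left hlam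

include hN

theorem exists_halfStep (l : Fin 2) (p : ℕ) (hp : p < 2) (ρ : DHFC.Op N) (ν : Fin N → Fin 4)
    (h : coeff ν (DHFC.conjChannel (C.rotLayer l * DHFC.brickLayer N p) ρ) ≠ 0) :
    ∃ μ, HalfStep C.doped p μ ν ∧
      ‖coeff ν (DHFC.conjChannel (C.rotLayer l * DHFC.brickLayer N p) ρ)‖
        ≤ 3 ^ DHFC.weight ν * ‖coeff μ ρ‖ := by
  rw [conjChannel_mul] at h ⊢
  obtain ⟨α, h1, h2, h3⟩ := exists_coeff_siteProd _ (rotLayer_mem_unitary C l) ν _ h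
  obtain ⟨μ, h4, h5⟩ := exists_coeff_brickLayer hN p hp α
  rw [h5] at h3
  exact ⟨μ, ⟨α, h4, h1, fun j hj => h2 j (if_neg hj)⟩, h3⟩

theorem periodUnitary_conjTranspose_mul :
    C.periodUnitary.conjTranspose * C.periodUnitary = 1 := by
  have key : ∀ U V : DHFC.Op N, U.conjTranspose * U = 1 → V.conjTranspose * V = 1 →
      (U * V).conjTranspose * (U * V) = 1 := by
    intro U V hU hV
    rw [Matrix.conjTranspose_mul, mul_assoc, ← mul_assoc _ U, hU, one_mul, hV]
  exact key _ _ (key _ _ (rotLayer_conjTranspose_mul C 1)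
      (brickLayer_conjTranspose_mul hN 1 (by norm_num)))
    (key _ _ (rotLayer_conjTranspose_mul C 0) (brickLayer_conjTranspose_mul hN 0 (by norm_num)))

theorem trace_floquet (γ : ℝ) (ρ : DHFC.Op N) : coeff 0 (C.floquet γ ρ) = coeff 0 ρ := by
  have h0 : DHFC.pauliString (0 : Fin N → Fin 4) = 1 := siteProd_one
  rw [DHFC.Circuit.floquet, LinearMap.comp_apply, coeff_noise]
  simp only [DHFC.weight, coeff, h0, one_mul, DHFC.conjChannel, LinearMap.coe_mk, AddHom.coe_mk]
  rw [Matrix.trace_mul_comm, ← mul_assoc, periodUnitary_conjTranspose_mul hN C]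
  simp

variable {γ : ℝ} {lam : ℂ} {ρ : DHFC.Op N}

/-- One period backwards from `ν` to the string contributing most. The factor `exp (4 * w)` pays for
the number of strings the two rotation layers mix, at most `3 ^ w * 3 ^ (2 * w) = 27 ^ w`. -/
theorem exists_step (hρ : C.floquet γ ρ = lam • ρ) (hlam : lam ≠ 0) (ν : Fin N → Fin 4)
    (h : coeff ν ρ ≠ 0) :
    ∃ μ mid, coeff μ ρ ≠ 0 ∧ HalfStep C.doped 0 μ mid ∧ HalfStep C.doped 1 mid ν ∧
      ‖lam‖ * ‖coeff ν ρ‖ ≤ Real.exp (-(γ - 4) * DHFC.weight ν) * ‖coeff μ ρ‖ := by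
  have h1 : lam * coeff ν ρ
      = (Real.exp (-γ * DHFC.weight ν) : ℂ) * coeff ν (DHFC.conjChannel C.periodUnitary ρ) := by
    rw [← coeff_noise, ← LinearMap.comp_apply, ← DHFC.Circuit.floquet, hρ]
    simp [coeff]
  have h2 : coeff ν (DHFC.conjChannel C.periodUnitary ρ) ≠ 0 := by
    intro h3
    rw [h3, mul_zero] at h1
    exact mul_ne_zero hlam h h1
  rw [DHFC.Circuit.periodUnitary, conjChannel_mul] at h1 h2
  obtain ⟨mid, hs1, hle1⟩ := exists_halfStep hN C 1 1 (by norm_num) _ ν h2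
  have h3 : coeff mid (DHFC.conjChannel (C.rotLayer 0 * DHFC.brickLayer N 0) ρ) ≠ 0 := by
    intro h4
    rw [h4, norm_zero, mul_zero] at hle1
    exact h2 (norm_le_zero_iff.mp hle1)
  obtain ⟨μ, hs0, hle0⟩ := exists_halfStep hN C 0 0 (by norm_num) _ mid h3
  have h5 : coeff μ ρ ≠ 0 := by
    intro h4
    rw [h4, norm_zero, mul_zero] at hle0
    exact h3 (norm_le_zero_iff.mp hle0)
  refine ⟨μ, mid, h5, hs0, hs1, ?_⟩
  set w := DHFC.weight ν
  have hw : DHFC.weight mid ≤ 2 * w := hs1.weight_le hN (by norm_num)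
  -- the numerical reason for strong dissipation: `27 ≤ exp 4`
  have h27 : (3 : ℝ) ^ w * 3 ^ DHFC.weight mid ≤ Real.exp (4 * w) := by
    calc (3 : ℝ) ^ w * 3 ^ DHFC.weight mid ≤ 3 ^ w * 3 ^ (2 * w) := by
          gcongr
          norm_num
      _ = 27 ^ w := by rw [pow_mul, ← mul_pow]; norm_num
      _ ≤ (Real.exp 4) ^ w := by
          gcongr
          rw [show (4 : ℝ) = ((4 : ℕ) : ℝ) * 1 by norm_num, Real.exp_nat_mul]
          have := Real.exp_one_gt_d9
          calc (27 : ℝ) ≤ 2.7 ^ 4 := by norm_num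
            _ ≤ _ := by gcongr; linarith
      _ = Real.exp (4 * w) := by rw [← Real.exp_nat_mul, mul_comm]
  calc ‖lam‖ * ‖coeff ν ρ‖
      = Real.exp (-γ * w) * ‖coeff ν (DHFC.conjChannel (C.rotLayer 1 * DHFC.brickLayer N 1)
          (DHFC.conjChannel (C.rotLayer 0 * DHFC.brickLayer N 0) ρ))‖ := by
        rw [← norm_mul, h1, norm_mul, Complex.norm_real, Real.norm_eq_abs, Real.abs_exp]
    _ ≤ Real.exp (-γ * w) * (3 ^ w * (3 ^ DHFC.weight mid * ‖coeff μ ρ‖)) := by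
        gcongr
        exact hle1.trans (by gcongr)
    _ = Real.exp (-γ * w) * (3 ^ w * 3 ^ DHFC.weight mid) * ‖coeff μ ρ‖ := by ring
    _ ≤ Real.exp (-γ * w) * Real.exp (4 * w) * ‖coeff μ ρ‖ := by gcongr
    _ = _ := by rw [← Real.exp_add]; ring_nf

/-- Following the largest contribution backwards in time, starting at the largest coefficient of
an eigenvector, gives a trajectory of Pauli strings whose total weight controls the eigenvalue. -/
theorem exists_backward_path (hρ : C.floquet γ ρ = lam • ρ) (hlam : lam ≠ 0) (h : ρ ≠ 0)
    (htr : coeff 0 ρ = 0) :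
    ∃ b mid : ℕ → Fin N → Fin 4, (∀ n, b n ≠ 0) ∧
      (∀ n, HalfStep C.doped 0 (b (n + 1)) (mid n)) ∧ (∀ n, HalfStep C.doped 1 (mid n) (b n)) ∧
      ∀ T, ‖lam‖ ^ T ≤ Real.exp (-(γ - 4) * ∑ n ∈ Finset.range T, (DHFC.weight (b n) : ℝ)) := by
  obtain ⟨ν₀, hmax⟩ := Finite.exists_max fun ν => ‖coeff ν ρ‖
  have hν₀ : coeff ν₀ ρ ≠ 0 := by
    obtain ⟨ν, hν⟩ := exists_coeff_ne_zero C hρ hlam h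
    have := (norm_pos_iff.mpr hν).trans_le (hmax ν)
    exact norm_pos_iff.mp this
  choose f mid hf h0 h1 hle using
    fun ν : {ν : Fin N → Fin 4 // coeff ν ρ ≠ 0} => exists_step hN C hρ hlam ν.1 ν.2
  let F : {ν : Fin N → Fin 4 // coeff ν ρ ≠ 0} → {ν : Fin N → Fin 4 // coeff ν ρ ≠ 0} :=
    fun ν => ⟨f ν, hf ν⟩
  let b : ℕ → {ν : Fin N → Fin 4 // coeff ν ρ ≠ 0} := fun n => F^[n] ⟨ν₀, hν₀⟩
  have hb : ∀ n, (b (n + 1)).1 = f (b n) := fun n => by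
    simp only [b, Function.iterate_succ_apply', F]
  refine ⟨fun n => (b n).1, fun n => mid (b n), fun n hn => ?_, fun n => ?_, fun n => h1 (b n),
    fun T => ?_⟩
  · exact (b n).2 (by rw [show (b n).1 = 0 from hn]; exact htr)
  · simp only [hb]; exact h0 (b n)
  · have key : ∀ T, ‖lam‖ ^ T * ‖coeff ν₀ ρ‖ ≤ Real.exp (-(γ - 4) *
        ∑ n ∈ Finset.range T, (DHFC.weight (b n).1 : ℝ)) * ‖coeff (b T).1 ρ‖ := by
      intro T
      induction T with
      | zero => simp [b]
      | succ T ih =>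
        have h2 := hle (b T)
        rw [← hb] at h2
        calc ‖lam‖ ^ (T + 1) * ‖coeff ν₀ ρ‖ = ‖lam‖ * (‖lam‖ ^ T * ‖coeff ν₀ ρ‖) := by ring
          _ ≤ ‖lam‖ * (Real.exp (-(γ - 4) *
              ∑ n ∈ Finset.range T, (DHFC.weight (b n).1 : ℝ)) * ‖coeff (b T).1 ρ‖) := by gcongr
          _ = Real.exp (-(γ - 4) * ∑ n ∈ Finset.range T, (DHFC.weight (b n).1 : ℝ)) *
              (‖lam‖ * ‖coeff (b T).1 ρ‖) := by ring
          _ ≤ Real.exp (-(γ - 4) * ∑ n ∈ Finset.range T, (DHFC.weight (b n).1 : ℝ)) *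
              (Real.exp (-(γ - 4) * DHFC.weight (b T).1) * ‖coeff (b (T + 1)).1 ρ‖) := by gcongr
          _ = _ := by
            rw [← mul_assoc, ← Real.exp_add, Finset.sum_range_succ, mul_add]
    have hpos := norm_pos_iff.mpr hν₀
    have h3 := (key T).trans (mul_le_mul_of_nonneg_left (hmax (b T).1) (Real.exp_pos _).le)
    exact le_of_mul_le_mul_right h3 hpos

end Floquet

/-! ### Space-time patterns of Pauli bits -/

/-- A space-time pattern of Pauli bits on a ring of `N` sites, unrolled to sites `x : ℤ`, through
`L` brickwork layers. The gate of layer `t` on the bond `(x, x + 1)`, where `x` has the parity of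
`t`, takes the bits at time `t` to those at time `t + 1`, except that on the sites of `D` nonzero
bits may become any other nonzero bits. -/
structure IsHistory (N : ℕ) (L : ℤ) (D : ℤ → Prop) (s : ℤ → ℤ → ZMod 2 × ZMod 2) : Prop where
  periodic : ∀ x t, s (x + N) t = s x t
  left_zero : ∀ x t, 0 ≤ t → t < L → 2 ∣ x - t →
    (s x (t + 1) = 0 ↔ outL (s x t) (s (x + 1) t) = 0)
  right_zero : ∀ x t, 0 ≤ t → t < L → 2 ∣ x - t →
    (s (x + 1) (t + 1) = 0 ↔ outR (s x t) (s (x + 1) t) = 0)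
  left : ∀ x t, 0 ≤ t → t < L → 2 ∣ x - t → ¬D x → s x (t + 1) = outL (s x t) (s (x + 1) t)
  right : ∀ x t, 0 ≤ t → t < L → 2 ∣ x - t → ¬D (x + 1) →
    s (x + 1) (t + 1) = outR (s x t) (s (x + 1) t)
  ne_zero : ∀ t, 0 ≤ t → t ≤ L → ∃ x, s x t ≠ 0

/-- No site of `D` lies within distance `ρ` of `x`. -/
def Clean (D : ℤ → Prop) (x ρ : ℤ) : Prop := ∀ y, |y - x| ≤ ρ → ¬D y

theorem Clean.shift {D : ℤ → Prop} {x y ρ σ : ℤ} (h : Clean D x ρ) (hy : |y - x| + σ ≤ ρ) :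
    Clean D y σ := by
  intro w hw
  refine h w ?_
  have : |w - x| ≤ |w - y| + |y - x| := abs_sub_le w y x
  omega

namespace IsHistory

variable {N : ℕ} {L : ℤ} {D : ℤ → Prop} {s : ℤ → ℤ → ZMod 2 × ZMod 2} (h : IsHistory N L D s)
include h

/-- If a site stays trivial, then the neighbouring gates act on nothing, so that its neighbour stays
trivial too: the circuit is dual-unitary, and can be run in the space direction. -/
theorem column_succ {x a b : ℤ} (ha : 0 ≤ a) (hb : b ≤ L)
    (hx : ∀ t, a ≤ t → t ≤ b → s x t = 0) (t : ℤ) (hat : a + 1 ≤ t) (htb : t + 1 ≤ b) :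
    s (x + 1) t = 0 := by
  have key : ∀ u v : ZMod 2 × ZMod 2, u = 0 → outL u v = 0 → v = 0 ∧ outR u v = 0 := by decide
  rcases Int.emod_two_eq_zero_or_one (x - t) with h2 | h2
  · have h3 : (2 : ℤ) ∣ x - t := Int.dvd_of_emod_eq_zero h2
    exact (key _ _ (hx t (by omega) (by omega))
      ((h.left_zero x t (by omega) (by omega) h3).mp (hx _ (by omega) (by omega)))).1
  · have h3 : (2 : ℤ) ∣ x - (t - 1) := by omega
    have h4 := h.left_zero x (t - 1) (by omega) (by omega) h3
    have h5 := h.right_zero x (t - 1) (by omega) (by omega) h3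
    rw [sub_add_cancel] at h4 h5
    exact h5.mpr (key _ _ (hx _ (by omega) (by omega)) (h4.mp (hx t (by omega) (by omega)))).2

/-- Iterating `column_succ`, the window shrinks by one at both ends with every site. -/
theorem column_add {x a b : ℤ} (ha : 0 ≤ a) (hb : b ≤ L)
    (hx : ∀ t, a ≤ t → t ≤ b → s x t = 0) (n : ℕ) :
    ∀ t, a + n ≤ t → t + n ≤ b → s (x + n) t = 0 := by
  induction n with
  | zero => simpa using fun t h1 h2 => hx t h1 h2
  | succ n ih =>
    intro t h1 h2
    push_cast at h1 h2 ⊢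
    rw [← add_assoc]
    exact h.column_succ (by omega) (by omega : b - n ≤ L)
      (fun t h3 h4 => ih t h3 (by omega)) t (by omega) (by omega)

theorem periodic_mul (x t k : ℤ) : s (x + k * N) t = s x t := by
  induction k with
  | zero => simp
  | succ k ih => rw [← ih, add_mul, one_mul, ← add_assoc, h.periodic]
  | pred k ih => rw [← ih, ← h.periodic]; congr 1; ring

/-- No site stays trivial for `2 * N` layers, as this would make a whole row trivial. -/
theorem exists_column_ne_zero (hN : 0 < N) (x : ℤ) {a b : ℤ} (ha : 0 ≤ a) (hb : b ≤ L)
    (hab : a + 2 * N ≤ b) : ∃ t, a ≤ t ∧ t ≤ b ∧ s x t ≠ 0 := by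
  by_contra! hcon
  obtain ⟨y, hy⟩ := h.ne_zero (a + N) (by omega) (by omega)
  have h1 := h.column_add ha hb hcon ((y - x) % N).toNat
  have h2 : 0 ≤ (y - x) % N := Int.emod_nonneg _ (by omega)
  have h3 : (y - x) % N < N := Int.emod_lt_of_pos _ (by omega)
  have h4 := h1 (a + N) (by omega) (by omega)
  rw [Int.toNat_of_nonneg h2] at h4
  have h5 : y = x + (y - x) % N + (y - x) / N * N := by
    have := Int.emod_add_ediv_mul (y - x) N
    linarith
  rw [h5, h.periodic_mul] at hy
  exact hy h4

theorem left_fst {x t : ℤ} (h0 : 1 ≤ t) (h1 : t ≤ L) (h2 : 2 ∣ x - (t - 1)) (hx : ¬D x) :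
    (s x t).1 = (s (x + 1) (t - 1)).2 := by
  have := h.left x (t - 1) (by omega) (by omega) h2 hx
  rw [sub_add_cancel] at this
  rw [this, outL]

theorem right_fst {x t : ℤ} (h0 : 1 ≤ t) (h1 : t ≤ L) (h2 : 2 ∣ x - t) (hx : ¬D x) :
    (s x t).1 = (s (x - 1) (t - 1)).2 := by
  have := h.right (x - 1) (t - 1) (by omega) (by omega) (by omega) (by simpa using hx)
  rw [sub_add_cancel, sub_add_cancel] at this
  rw [this, outR]

theorem right_snd {x t : ℤ} (h0 : 1 ≤ t) (h1 : t < L) (h2 : 2 ∣ x - t) (hx : ¬D x)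
    (hx' : ¬D (x + 1)) :
    (s (x + 1) (t + 1)).2 + (s x t).2 + (s (x - 1) (t - 1)).2 + (s (x + 1) t).2 = 0 := by
  rw [h.right x t (by omega) h1 h2 hx', outR, ← h.right_fst h0 h1.le h2 hx]
  generalize (s x t).1 = a, (s x t).2 = b, (s (x + 1) t).2 = c
  revert a b c; decide

theorem left_snd {x t : ℤ} (h0 : 1 ≤ t) (h1 : t < L) (h2 : 2 ∣ x - t) (hx : ¬D x)
    (hx' : ¬D (x + 1)) :
    (s x (t + 1)).2 + (s (x + 1) t).2 + (s (x + 2) (t - 1)).2 + (s x t).2 = 0 := by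
  have h3 := h.left_fst (x := x + 1) h0 h1.le (by omega) hx'
  rw [h.left x t (by omega) h1 h2 hx, outL, show x + 2 = x + 1 + 1 by ring, ← h3]
  generalize (s (x + 1) t).1 = a, (s x t).2 = b, (s (x + 1) t).2 = c
  revert a b c; decide

/-- Away from the doped sites, the `z`-bits satisfy a linear relation on the eight sites around any
space-time point. -/
theorem king {x t : ℤ} (hD : Clean D x 3) (h0 : 3 ≤ t) (h1 : t + 3 ≤ L) :
    (s (x + 2) t).2 + (s (x - 2) t).2 + (s x (t + 2)).2 + (s x (t - 2)).2
      + (s (x + 1) (t + 1)).2 + (s (x + 1) (t - 1)).2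
      + (s (x - 1) (t + 1)).2 + (s (x - 1) (t - 1)).2 = 0 := by
  have c : ∀ d : ℤ, |d| ≤ 3 → ¬D (x + d) := fun d hd => hD _ (by simpa using hd)
  have c0 := c 0 (by norm_num)
  have c1 := c 1 (by norm_num)
  have c2 := c 2 (by norm_num)
  have c3 := c (-1) (by norm_num)
  have c4 := c (-2) (by norm_num)
  have two : (2 : ZMod 2) = 0 := rfl
  simp only [← sub_eq_add_neg, add_zero] at c0 c3 c4
  -- `right_snd` and `left_snd` express the bits of each mover by those of the other one
  rcases Int.emod_two_eq_zero_or_one (x - t) with h2 | h2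
  · have r1 := h.right_snd (x := x - 1) (t := t + 1) (by omega) (by omega) (by omega) c3
      (by simpa using c0)
    have r2 := h.right_snd (x := x) (t := t) (by omega) (by omega) (by omega) c0 c1
    have r3 := h.right_snd (x := x + 1) (t := t - 1) (by omega) (by omega) (by omega) c1
      (by rw [add_assoc]; exact c2)
    have r4 := h.left_snd (x := x) (t := t) (by omega) (by omega) (by omega) c0 c1
    ring_nf at r1 r2 r3 r4 ⊢
    linear_combination r1 + r2 + r3 + r4 - (s x t).2 * two - (s (1 + x) t).2 * two
      - (s x (1 + t)).2 * two - (s (2 + x) (-1 + t)).2 * two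
  · have r1 := h.left_snd (x := x) (t := t + 1) (by omega) (by omega) (by omega) c0 c1
    have r2 := h.left_snd (x := x - 1) (t := t) (by omega) (by omega) (by omega) c3
      (by simpa using c0)
    have r3 := h.left_snd (x := x - 2) (t := t - 1) (by omega) (by omega) (by omega) c4
      (by rw [show x - 2 + 1 = x - 1 by ring]; exact c3)
    have r4 := h.right_snd (x := x - 1) (t := t) (by omega) (by omega) (by omega) c3
      (by simpa using c0)
    ring_nf at r1 r2 r3 r4 ⊢
    linear_combination r1 + r2 + r3 + r4 - (s x t).2 * two - (s (-1 + x) t).2 * two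
      - (s x (1 + t)).2 * two - (s (-2 + x) (-1 + t)).2 * two

/-- Away from the doped sites, the `z`-bits cannot vanish on two adjacent sites for long. -/
theorem exists_snd_ne_zero (hN : 0 < N) {x : ℤ} (hD : Clean D x 3) {a b : ℤ} (ha : 0 ≤ a)
    (hb : b ≤ L) (hab : a + 2 * N + 4 ≤ b) :
    ∃ t, a ≤ t ∧ t ≤ b ∧ ((s x t).2 ≠ 0 ∨ (s (x + 1) t).2 ≠ 0) := by
  by_contra! hcon
  have c : ∀ d : ℤ, |d| ≤ 3 → ¬D (x + d) := fun d hd => hD _ (by simpa using hd)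
  have c0 := c 0 (by norm_num)
  have c1 := c 1 (by norm_num)
  rw [add_zero] at c0
  obtain ⟨t, h1, h2, h3⟩ := h.exists_column_ne_zero hN x (a := a + 1) (b := b - 1) (by omega)
    (by omega) (by omega)
  apply h3
  rcases Int.emod_two_eq_zero_or_one (x - t) with h4 | h4
  · have h5 := h.right x t (by omega) (by omega) (by omega) c1
    have h6 := hcon t (by omega) (by omega)
    have h7 := hcon (t + 1) (by omega) (by omega)
    rw [h5, outR, h6.1, h6.2] at h7
    exact Prod.ext (by simpa using h7.2) h6.1
  · have h5 := h.left_fst (x := x) (t := t) (by omega) (by omega) (by omega) c0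
    have h6 := hcon t (by omega) (by omega)
    have h7 := hcon (t - 1) (by omega) (by omega)
    exact Prod.ext (h5.trans h7.2) h6.1

end IsHistory

/-! ### The wave equation in characteristic two -/

section Wave

variable {K : Type*} [Field K] {D : ℤ → Prop} {L : ℤ}

/-- The relation `φ (x + m, t) + φ (x - m, t) = c * (φ (x, t + m) + φ (x, t - m))` at all points
which are far from `D` and from the ends of the time interval. -/
def Wave (D : ℤ → Prop) (L : ℤ) (φ : ℤ → ℤ → K) (c : K) (m : ℤ) : Prop :=
  ∀ x t, Clean D x (m + 2) → m + 2 ≤ t → t + m + 2 ≤ L →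
    φ (x + m) t + φ (x - m) t = c * (φ x (t + m) + φ x (t - m))

/-- The combination of `z`-bits which satisfies a wave equation: the relation `IsHistory.king`
factors over the field with four elements. -/
def waveField [Algebra (ZMod 2) K] (ω : K) (s : ℤ → ℤ → ZMod 2 × ZMod 2) (x t : ℤ) : K :=
  algebraMap (ZMod 2) K (s (x + 1) t).2 + algebraMap (ZMod 2) K (s (x - 1) t).2
    + ω ^ 2 * (algebraMap (ZMod 2) K (s x (t + 1)).2 + algebraMap (ZMod 2) K (s x (t - 1)).2)

theorem IsHistory.wave [Algebra (ZMod 2) K] {ω : K} (hω : ω ^ 2 + ω + 1 = 0) (two : (2 : K) = 0)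
    {N : ℕ} {s : ℤ → ℤ → ZMod 2 × ZMod 2} (h : IsHistory N L D s) : Wave D L (waveField ω s) ω 1 := by
  intro x t hD h0 h1
  have hk := congrArg (algebraMap (ZMod 2) K) (h.king (x := x) (t := t) hD (by omega) (by omega))
  simp only [map_add, map_zero] at hk
  obtain ⟨f, hf⟩ : ∃ f : ℤ → ℤ → K, ∀ x t, algebraMap (ZMod 2) K (s x t).2 = f x t :=
    ⟨_, fun _ _ => rfl⟩
  simp only [waveField, hf] at hk ⊢
  ring_nf at hk ⊢
  linear_combination hk
    + (f (1 + x) (1 + t) + f (1 + x) (-1 + t) + f (-1 + x) (1 + t) + f (-1 + x) (-1 + t))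
      * (hω - (1 + ω) * two)
    + (f x (2 + t) + f x (-2 + t)) * ((1 - ω) * hω - two)
    + f x t * (1 - ω ^ 3) * two

variable {φ : ℤ → ℤ → K}

/-- Applying the wave equation twice: in characteristic two, cross terms cancel. -/
theorem Wave.double (two : (2 : K) = 0) {c : K} {m : ℤ} (hm : 0 ≤ m) (h : Wave D L φ c m) :
    Wave D L φ (c ^ 2) (2 * m) := by
  intro x t hD h0 h1
  have r1 := h (x + m) t (hD.shift (by simp [abs_of_nonneg hm]; omega)) (by omega) (by omega)
  have r2 := h (x - m) t (hD.shift (by simp [abs_of_nonneg hm]; omega)) (by omega) (by omega)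
  have r3 := h x (t + m) (hD.shift (by simp; omega)) (by omega) (by omega)
  have r4 := h x (t - m) (hD.shift (by simp; omega)) (by omega) (by omega)
  ring_nf at r1 r2 r3 r4 ⊢
  linear_combination r1 + r2 + c * (r3 + r4) - (1 - c ^ 2) * φ x t * two

theorem Wave.pow_sixteen (two : (2 : K) = 0) {ω : K} (hω : ω ^ 2 + ω + 1 = 0)
    (h : Wave D L φ ω 1) (j : ℕ) : Wave D L φ ω (16 ^ j) := by
  induction j with
  | zero => simpa using h
  | succ j ih =>
    have hp : (0 : ℤ) ≤ 16 ^ j := by positivity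
    have h4 := (((ih.double two hp).double two (by positivity)).double two
      (by positivity)).double two (by positivity)
    have e1 : (((ω ^ 2) ^ 2) ^ 2) ^ 2 = ω := by
      have h3 : ω ^ 3 = 1 := by linear_combination (ω - 1) * hω
      calc (((ω ^ 2) ^ 2) ^ 2) ^ 2 = (ω ^ 3) ^ 5 * ω := by ring
        _ = ω := by rw [h3]; ring
    have e2 : (2 * (2 * (2 * (2 * 16 ^ j))) : ℤ) = 16 ^ (j + 1) := by ring
    rwa [e1, e2] at h4

/-- The displacements `±3`, `±1`, in time, of the cubed wave equation. -/
def timeStep : Fin 4 → ℤ := ![3, -3, 1, -1]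

/-- The displacements `±3`, in space, of the cubed wave equation. -/
def spaceStep : Fin 2 → ℤ := ![3, -3]

/-- The cube of the wave equation. As `ω ^ 3 = 1`, the cross terms combine into a relation between
two points in space and four points in time. -/
theorem Wave.cubic (two : (2 : K) = 0) {ω : K} (hω : ω ^ 2 + ω + 1 = 0) {m : ℤ} (hm : 0 ≤ m)
    (h : Wave D L φ ω m) {x t : ℤ} (hD : Clean D x (3 * m + 2)) (h0 : 3 * m + 2 ≤ t)
    (h1 : t + 3 * m + 2 ≤ L) :
    ∑ b, φ (x + spaceStep b * m) t
      = ∑ c, (![1, 1, ω ^ 2, ω ^ 2] : Fin 4 → K) c * φ x (t + timeStep c * m) := by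
  have a2 : |2 * m| = 2 * m := abs_of_nonneg (by omega)
  have a1 : |m| = m := abs_of_nonneg hm
  have e : ∀ d : ℤ, |d| ≤ 2 * m → Clean D (x + d) (m + 2) := fun d hd =>
    hD.shift (by rw [add_sub_cancel_left]; omega)
  have c2 := e (2 * m) (by omega)
  have c1 := e m (by omega)
  have c0 := e 0 (by simp; omega)
  have d1 := e (-m) (by rw [abs_neg]; omega)
  have d2 := e (-(2 * m)) (by rw [abs_neg]; omega)
  have r1 := h _ t c2 (by omega) (by omega)
  have r2 := h _ t d2 (by omega) (by omega)
  have r3 := h _ (t + m) c1 (by omega) (by omega)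
  have r4 := h _ (t - m) c1 (by omega) (by omega)
  have r5 := h _ (t + m) d1 (by omega) (by omega)
  have r6 := h _ (t - m) d1 (by omega) (by omega)
  have r7 := h _ (t + 2 * m) c0 (by omega) (by omega)
  have r8 := h _ t c0 (by omega) (by omega)
  have r9 := h _ (t - 2 * m) c0 (by omega) (by omega)
  simp only [Fin.sum_univ_two, Fin.sum_univ_four, spaceStep, timeStep, Matrix.cons_val,
    add_comm t]
  ring_nf at r1 r2 r3 r4 r5 r6 r7 r8 r9 ⊢
  linear_combination r1 + r2 + ω * (r3 + r4 + r5 + r6) + ω ^ 2 * (r7 + 2 * r8 + r9) - r8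
    + (ω - 1) * (φ x (m * 3 + t) + φ x (-(m * 3) + t) + 3 * (φ x (m + t) + φ x (-m + t))) * hω
    - (φ x (m + t) + φ x (-m + t)) * hω + (2 - ω) * (φ x (m + t) + φ x (-m + t)) * two

/-- The displacement with digits `v (c i)` in base `16`, in units of `m`. -/
def shift {n r : ℕ} (v : Fin n → ℤ) (m : ℤ) (c : Fin r → Fin n) : ℤ :=
  ∑ i, v (c i) * (m * 16 ^ (i : ℕ))

/-- The largest displacement with `r` digits of size at most `3`. -/
def reach (m : ℤ) (r : ℕ) : ℤ := ∑ i : Fin r, 3 * (m * 16 ^ (i : ℕ))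

theorem shift_cons {n r : ℕ} (v : Fin n → ℤ) (m : ℤ) (a : Fin n) (c : Fin r → Fin n) :
    shift v m (Fin.cons a c : Fin (r + 1) → Fin n) = v a * m + shift v (16 * m) c := by
  simp only [shift, Fin.sum_univ_succ, Fin.cons_zero, Fin.cons_succ, Fin.val_zero, pow_zero,
    mul_one, Fin.val_succ]
  congr 1
  exact Finset.sum_congr rfl fun i _ => by ring

theorem reach_succ (m : ℤ) (r : ℕ) : reach m (r + 1) = 3 * m + reach (16 * m) r := by
  simp only [reach, Fin.sum_univ_succ, Fin.val_zero, pow_zero, mul_one, Fin.val_succ]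
  congr 1
  exact Finset.sum_congr rfl fun i _ => by ring

theorem five_mul_reach (m : ℤ) (r : ℕ) : 5 * reach m r = m * 16 ^ r - m := by
  induction r generalizing m with
  | zero => simp [reach]
  | succ r ih => rw [reach_succ, mul_add, ih]; ring

theorem abs_shift_le {n r : ℕ} {v : Fin n → ℤ} (hv : ∀ a, |v a| ≤ 3) {m : ℤ} (hm : 0 ≤ m)
    (c : Fin r → Fin n) : |shift v m c| ≤ reach m r := by
  refine (Finset.abs_sum_le_sum_abs _ _).trans (Finset.sum_le_sum fun i _ => ?_)
  have : (0 : ℤ) ≤ m * 16 ^ (i : ℕ) := by positivity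
  rw [abs_mul, abs_of_nonneg this]
  exact mul_le_mul_of_nonneg_right (hv _) this

theorem abs_timeStep_le (a : Fin 4) : |timeStep a| ≤ 3 := by revert a; decide

theorem abs_spaceStep_le (a : Fin 2) : |spaceStep a| ≤ 3 := by revert a; decide

theorem shift_timeStep_injective {r : ℕ} {m : ℤ} (hm : 0 < m) :
    Function.Injective (shift timeStep m : (Fin r → Fin 4) → ℤ) := by
  induction r generalizing m with
  | zero => exact fun a b _ => Subsingleton.elim a b
  | succ r ih =>
    intro c c' hcc
    induction c using Fin.consCases with | _ a c => ?_
    induction c' using Fin.consCases with | _ a' c' => ?_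
    rw [shift_cons, shift_cons] at hcc
    have hdvd : ∀ c : Fin r → Fin 4, ∃ k, shift timeStep (16 * m) c = 16 * m * k := by
      intro c
      refine ⟨shift timeStep 1 c, ?_⟩
      simp only [shift, Finset.mul_sum]
      exact Finset.sum_congr rfl fun i _ => by ring
    obtain ⟨k, hk⟩ := hdvd c
    obtain ⟨k', hk'⟩ := hdvd c'
    have h1 : timeStep a + 16 * k = timeStep a' + 16 * k' := by
      refine mul_right_cancel₀ hm.ne' ?_
      rw [hk, hk'] at hcc
      linarith
    have h2 : a = a' := by
      have h3 : ∀ a a' : Fin 4, (timeStep a - timeStep a') % 16 = 0 → a = a' := by decide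
      exact h3 a a' (by omega)
    subst h2
    rw [ih (m := 16 * m) (by omega) (add_left_cancel hcc)]

/-- The product of the cubed wave equations at the scales `m, 16 m, …`: a sum over `2 ^ r` columns
equals a sum over `4 ^ r` times. -/
theorem sum_shift_eq {ω : K} {r j : ℕ}
    (hc : ∀ (j : ℕ) (x t : ℤ), Clean D x (3 * 16 ^ j + 2) → 3 * 16 ^ j + 2 ≤ t →
      t + 3 * 16 ^ j + 2 ≤ L → ∑ b, φ (x + spaceStep b * 16 ^ j) t
        = ∑ c, (![1, 1, ω ^ 2, ω ^ 2] : Fin 4 → K) c * φ x (t + timeStep c * 16 ^ j))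
    {x t : ℤ} (hD : Clean D x (reach (16 ^ j) r + 2)) (h0 : reach (16 ^ j) r + 2 ≤ t)
    (h1 : t + reach (16 ^ j) r + 2 ≤ L) :
    ∑ b : Fin r → Fin 2, φ (x + shift spaceStep (16 ^ j) b) t
      = ∑ c : Fin r → Fin 4, (∏ i, (![1, 1, ω ^ 2, ω ^ 2] : Fin 4 → K) (c i))
          * φ x (t + shift timeStep (16 ^ j) c) := by
  induction r generalizing j x t with
  | zero => simp [shift]
  | succ r ih =>
    have hj : (16 * 16 ^ j : ℤ) = 16 ^ (j + 1) := by ring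
    have hpos : (0 : ℤ) ≤ 16 ^ j := by positivity
    rw [reach_succ, hj] at hD h0 h1
    have hr : 0 ≤ reach (16 ^ (j + 1)) r := by
      have := five_mul_reach (16 ^ (j + 1)) r
      have h2 : (1 : ℤ) ≤ 16 ^ r := one_le_pow₀ (by norm_num)
      have h3 : (0 : ℤ) ≤ 16 ^ (j + 1) := by positivity
      nlinarith
    have hcons : ∀ (n : ℕ) (f : (Fin (r + 1) → Fin n) → K),
        ∑ c, f c = ∑ a, ∑ c : Fin r → Fin n, f (Fin.cons a c : Fin (r + 1) → Fin n) := by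
      intro n f
      rw [← (Fin.consEquiv fun _ => Fin n).sum_comp, Fintype.sum_prod_type]
      rfl
    rw [hcons, hcons, Finset.sum_comm (γ := Fin 4)]
    simp only [shift_cons, Fin.prod_univ_succ, Fin.cons_zero, Fin.cons_succ, hj]
    calc ∑ a, ∑ b : Fin r → Fin 2, φ (x + (spaceStep a * 16 ^ j
            + shift spaceStep (16 ^ (j + 1)) b)) t
        = ∑ a, ∑ c : Fin r → Fin 4, (∏ i, (![1, 1, ω ^ 2, ω ^ 2] : Fin 4 → K) (c i))
          * φ (x + spaceStep a * 16 ^ j) (t + shift timeStep (16 ^ (j + 1)) c) := by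
          refine Finset.sum_congr rfl fun a _ => ?_
          simp only [← add_assoc]
          refine ih (hD.shift ?_) (by omega) (by omega)
          rw [add_sub_cancel_left, abs_mul, abs_of_nonneg hpos]
          have := mul_le_mul_of_nonneg_right (abs_spaceStep_le a) hpos
          omega
      _ = ∑ c : Fin r → Fin 4, (∏ i, (![1, 1, ω ^ 2, ω ^ 2] : Fin 4 → K) (c i))
          * ∑ a, φ (x + spaceStep a * 16 ^ j) (t + shift timeStep (16 ^ (j + 1)) c) := by
          rw [Finset.sum_comm]
          simp only [Finset.mul_sum]
      _ = _ := by
          refine Finset.sum_congr rfl fun c _ => ?_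
          have h2 := abs_le.mp (abs_shift_le abs_timeStep_le
            (by positivity : (0 : ℤ) ≤ 16 ^ (j + 1)) c)
          rw [hc j x _ (hD.shift (by simp; omega)) (by omega) (by omega), Finset.mul_sum]
          refine Finset.sum_congr rfl fun a _ => ?_
          rw [add_assoc, add_comm (shift _ _ _), mul_left_comm, mul_assoc]

end Wave

/-! ### Counting nonzero values of a wave -/

/-- The number of times `t` with `2 ≤ t < L` at which `P x t` holds. -/
noncomputable def columnCount (L : ℤ) (P : ℤ → ℤ → Prop) (x : ℤ) : ℕ :=
  letI := Classical.decPred (P x)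
  ((Finset.Ico 2 L).filter (P x)).card

theorem card_le_columnCount {ι : Type*} {L : ℤ} {P : ℤ → ℤ → Prop} {x : ℤ}
    (S : Finset ι) (f : ι → ℤ) (hf : Set.InjOn f S)
    (h : ∀ i ∈ S, 2 ≤ f i ∧ f i < L ∧ P x (f i)) : S.card ≤ columnCount L P x := by
  classical
  rw [columnCount]
  refine Finset.card_le_card_of_injOn f (fun i hi => ?_) hf
  simp only [Finset.coe_filter, Finset.mem_Ico, Set.mem_ofPred_eq]
  exact ⟨⟨(h i hi).1, (h i hi).2.1⟩, (h i hi).2.2⟩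

theorem columnCount_le_of_imp {L : ℤ} {P Q : ℤ → ℤ → Prop} {x y : ℤ}
    (h : ∀ t, 2 ≤ t → t < L → P x t → Q y t) : columnCount L P x ≤ columnCount L Q y := by
  classical
  rw [columnCount, columnCount]
  refine Finset.card_le_card fun t ht => ?_
  simp only [Finset.mem_filter, Finset.mem_Ico] at ht ⊢
  exact ⟨ht.1, h t ht.1.1 ht.1.2 ht.2⟩

theorem reach_bounds {a r p : ℕ} (ha : a < p) :
    0 ≤ reach (16 ^ (r * a)) r ∧ 2 * reach (16 ^ (r * a)) r ≤ 16 ^ (r * p) ∧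
      2 * reach (16 ^ (r * a)) r < 16 ^ (r * (a + 1)) := by
  have h1 := five_mul_reach (16 ^ (r * a)) r
  have h2 : (1 : ℤ) ≤ 16 ^ r := one_le_pow₀ (by norm_num)
  have h3 : (1 : ℤ) ≤ 16 ^ (r * a) := one_le_pow₀ (by norm_num)
  have h4 : (16 : ℤ) ^ (r * (a + 1)) = 16 ^ (r * a) * 16 ^ r := by rw [mul_add, mul_one, pow_add]
  have h5 : (16 : ℤ) ^ (r * (a + 1)) ≤ 16 ^ (r * p) :=
    pow_le_pow_right₀ (by norm_num) (Nat.mul_le_mul_left r ha)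
  have h6 : (16 : ℤ) ^ (r * a) ≤ 16 ^ (r * a) * 16 ^ r := le_mul_of_one_le_right (by omega) h2
  rw [← h4] at h1 h6
  omega

/-- Differences of displacements built from disjoint ranges of scales do not agree. -/
theorem shift_sub_ne {r a a' : ℕ} (haa : a < a') {c e c' e' : Fin r → Fin 4}
    (hne : shift timeStep (16 ^ (r * a)) c ≠ shift timeStep (16 ^ (r * a)) e) :
    shift timeStep (16 ^ (r * a)) c - shift timeStep (16 ^ (r * a)) e
      ≠ shift timeStep (16 ^ (r * a')) c' - shift timeStep (16 ^ (r * a')) e' := by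
  intro h
  have hdvd : ∀ c : Fin r → Fin 4, (16 ^ (r * (a + 1)) : ℤ) ∣ shift timeStep (16 ^ (r * a')) c := by
    intro c
    refine Finset.dvd_sum fun i _ => Dvd.dvd.mul_left (Dvd.dvd.mul_right ?_ _) _
    exact pow_dvd_pow _ (Nat.mul_le_mul_left r haa)
  have h1 : (16 ^ (r * (a + 1)) : ℤ) ∣
      shift timeStep (16 ^ (r * a)) c - shift timeStep (16 ^ (r * a)) e := by
    rw [h]; exact dvd_sub (hdvd _) (hdvd _)
  have h2 := abs_le.mp (abs_shift_le abs_timeStep_le (by positivity : (0 : ℤ) ≤ 16 ^ (r * a)) c)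
  have h3 := abs_le.mp (abs_shift_le abs_timeStep_le (by positivity : (0 : ℤ) ≤ 16 ^ (r * a)) e)
  have h4 := (reach_bounds (r := r) (Nat.lt_succ_self a)).2.2
  have h5 := Int.eq_zero_of_abs_lt_dvd h1 (by rw [abs_lt]; omega)
  exact hne (sub_eq_zero.mp h5)

section Count

variable {K : Type*} [Field K] {D : ℤ → Prop} {L : ℤ} {φ : ℤ → ℤ → K} {ω : K}

/-- A nonzero value of a solution of the wave equation forces many others. Each of the `p` ranges of
scales gives an equation between `2 ^ r` columns and `4 ^ r` times. If no other point of the column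
`x` interferes, each of these times carries a nonzero value in one of the columns. A point of
the column `x` can only interfere for one range. -/
theorem Wave.le_sum_columnCount (two : (2 : K) = 0) (hω : ω ^ 2 + ω + 1 = 0)
    (h : Wave D L φ ω 1) (r p : ℕ) {x t : ℤ} (hD : Clean D x (16 ^ (r * p) + 2))
    (h0 : 16 ^ (r * p) + 2 ≤ t) (h1 : t + 16 ^ (r * p) + 2 ≤ L) (hx : φ x t ≠ 0) :
    4 ^ r * p ≤ ∑ a ∈ Finset.range p, ∑ b : Fin r → Fin 2,
        columnCount L (fun x t => φ x t ≠ 0) (x + shift spaceStep (16 ^ (r * a)) b)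
      + 4 ^ r * columnCount L (fun x t => φ x t ≠ 0) x := by
  classical
  set S := columnCount L (fun x t => φ x t ≠ 0) with hS
  have hω0 : ω ≠ 0 := by
    rintro rfl
    simp at hω
  -- the ranges of scales for which another point of the column `x` interferes
  let bad : ℕ → Prop := fun a => ∃ c e : Fin r → Fin 4,
    shift timeStep (16 ^ (r * a)) c ≠ shift timeStep (16 ^ (r * a)) e ∧
    φ x (t + (shift timeStep (16 ^ (r * a)) c - shift timeStep (16 ^ (r * a)) e)) ≠ 0
  have hbound : ∀ a (c : Fin r → Fin 4), |shift timeStep (16 ^ (r * a)) c|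
      ≤ reach (16 ^ (r * a)) r := fun a c => abs_shift_le abs_timeStep_le (by positivity) c
  have hbad : ((Finset.range p).filter bad).card ≤ S x := by
    choose! c e hne hφ using fun a (ha : bad a) => ha
    rw [← Finset.card_attach]
    refine card_le_columnCount _ (fun a => t + (shift timeStep (16 ^ (r * a.1)) (c a.1)
      - shift timeStep (16 ^ (r * a.1)) (e a.1))) ?_ ?_
    · rintro ⟨a, ha⟩ - ⟨a', ha'⟩ - haa
      simp only [add_right_inj] at haa
      rcases lt_trichotomy a a' with hlt | heq | hgt
      · exact absurd haa (shift_sub_ne hlt (hne a (Finset.mem_filter.mp ha).2))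
      · exact Subtype.ext heq
      · exact absurd haa.symm (shift_sub_ne hgt (hne a' (Finset.mem_filter.mp ha').2))
    · rintro ⟨a, ha⟩ -
      obtain ⟨hap, hab⟩ := Finset.mem_filter.mp ha
      have hr := reach_bounds (r := r) (Finset.mem_range.mp hap)
      have h2 := abs_le.mp (hbound a (c a))
      have h3 := abs_le.mp (hbound a (e a))
      exact ⟨by simp only; omega, by simp only; omega, hφ a hab⟩
  have hgood : ∀ a < p, ¬bad a →
      4 ^ r ≤ ∑ b : Fin r → Fin 2, S (x + shift spaceStep (16 ^ (r * a)) b) := by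
    intro a hap hab
    have hr := reach_bounds (r := r) hap
    have hex : ∀ c : Fin r → Fin 4, ∃ b : Fin r → Fin 2,
        φ (x + shift spaceStep (16 ^ (r * a)) b) (t - shift timeStep (16 ^ (r * a)) c) ≠ 0 := by
      intro c
      by_contra! hcon
      have h2 := abs_le.mp (hbound a c)
      have h3 := sum_shift_eq (r := r) (j := r * a) (fun j x t =>
        (h.pow_sixteen two hω j).cubic two hω (by positivity)) (x := x)
        (t := t - shift timeStep (16 ^ (r * a)) c) (hD.shift (by simp; omega)) (by omega)
        (by omega)
      rw [Finset.sum_eq_zero fun b _ => hcon b, Finset.sum_eq_single c, sub_add_cancel] at h3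
      · have hcoef : ∀ d : Fin 4, (![1, 1, ω ^ 2, ω ^ 2] : Fin 4 → K) d ≠ 0 := by
          intro d; fin_cases d <;> simp [hω0]
        exact mul_ne_zero (Finset.prod_ne_zero_iff.mpr fun i _ => hcoef _) hx h3.symm
      · intro e _ hec
        rw [mul_eq_zero]
        right
        by_contra h4
        refine hab ⟨e, c, fun h5 => hec (shift_timeStep_injective (by positivity) h5), ?_⟩
        rwa [show t + (shift timeStep (16 ^ (r * a)) e - shift timeStep (16 ^ (r * a)) c)
          = t - shift timeStep (16 ^ (r * a)) c + shift timeStep (16 ^ (r * a)) e by ring]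
      · simp
    calc 4 ^ r = (Finset.univ : Finset (Fin r → Fin 4)).card := by simp
      _ ≤ ∑ b : Fin r → Fin 2, (Finset.univ.filter fun c : Fin r → Fin 4 =>
            φ (x + shift spaceStep (16 ^ (r * a)) b)
              (t - shift timeStep (16 ^ (r * a)) c) ≠ 0).card := by
          refine le_trans (Finset.card_le_card fun c _ => ?_) Finset.card_biUnion_le
          simpa using hex c
      _ ≤ _ := by
          refine Finset.sum_le_sum fun b _ => card_le_columnCount _
            (fun c => t - shift timeStep (16 ^ (r * a)) c) (fun c _ e _ hce => ?_) fun c hc => ?_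
          · exact shift_timeStep_injective (by positivity) (sub_right_injective hce)
          · have h2 := abs_le.mp (hbound a c)
            exact ⟨by omega, by omega, (Finset.mem_filter.mp hc).2⟩
  calc 4 ^ r * p = ∑ a ∈ Finset.range p, 4 ^ r := by simp [mul_comm]
    _ ≤ ∑ a ∈ Finset.range p, (∑ b : Fin r → Fin 2, S (x + shift spaceStep (16 ^ (r * a)) b)
          + if bad a then 4 ^ r else 0) := by
        refine Finset.sum_le_sum fun a ha => ?_
        split_ifs with hab
        · exact Nat.le_add_left _ _
        · exact hgood a (Finset.mem_range.mp ha) hab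
    _ = _ + 4 ^ r * ((Finset.range p).filter bad).card := by
        rw [Finset.sum_add_distrib, ← Finset.sum_filter, Finset.sum_const, smul_eq_mul, mul_comm]
    _ ≤ _ := by gcongr

end Count

theorem sum_range_periodic {N : ℕ} {f : ℤ → ℕ} (hf : ∀ x, f (x + N) = f x) (d : ℤ) :
    ∑ x ∈ Finset.range N, f (x + d) = ∑ x ∈ Finset.range N, f x := by
  have key : ∀ d : ℤ, ∑ x ∈ Finset.range N, f (x + (d + 1)) = ∑ x ∈ Finset.range N, f (x + d) := by
    intro d
    have h1 := Finset.sum_range_succ (fun x : ℕ => f (x + d)) N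
    have h2 := Finset.sum_range_succ' (fun x : ℕ => f (x + d)) N
    rw [h1] at h2
    have h3 : f (N + d) = f ((0 : ℕ) + d) := by rw [add_comm, hf]; simp
    rw [h3] at h2
    have h4 := add_right_cancel h2
    rw [h4]
    exact Finset.sum_congr rfl fun x _ => by push_cast; ring_nf
  induction d with
  | zero => simp
  | succ k ih => rw [key, ih]
  | pred k ih => rw [← ih, ← key]; simp

/-! ### Activity of space-time patterns -/

/-- The number of times `1 ≤ t ≤ L` at which the site `x` carries a nontrivial Pauli matrix. -/
noncomputable def activity (L : ℤ) (s : ℤ → ℤ → ZMod 2 × ZMod 2) (x : ℤ) : ℕ :=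
  ((Finset.Icc 1 L).filter fun t => s x t ≠ 0).card

namespace IsHistory

variable {N : ℕ} {L : ℤ} {D : ℤ → Prop} {s : ℤ → ℤ → ZMod 2 × ZMod 2} (h : IsHistory N L D s)

theorem columnCount_waveField_le {K : Type*} [Field K] [Algebra (ZMod 2) K] (ω : K)
    (s : ℤ → ℤ → ZMod 2 × ZMod 2) (L x : ℤ) :
    columnCount L (fun x t => waveField ω s x t ≠ 0) x
      ≤ activity L s (x + 1) + activity L s (x - 1) + 2 * activity L s x := by
  classical
  set F : ℤ → Finset ℤ := fun y => (Finset.Icc 1 L).filter fun t => s y t ≠ 0 with hF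
  have hsub : (Finset.Ico 2 L).filter (fun t => waveField ω s x t ≠ 0) ⊆
      F (x + 1) ∪ F (x - 1) ∪ ((F x).image (· - 1) ∪ (F x).image (· + 1)) := by
    intro t ht
    simp only [Finset.mem_filter, Finset.mem_Ico] at ht
    by_contra hcon
    simp only [hF, Finset.mem_union, Finset.mem_image, Finset.mem_filter, Finset.mem_Icc,
      not_or, not_exists, not_and, not_not, and_imp] at hcon
    obtain ⟨⟨h1, h2⟩, h3, h4⟩ := hcon
    have h1 := h1 (by omega) (by omega)
    have h2 := h2 (by omega) (by omega)
    have h3 : s x (t + 1) = 0 := by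
      by_contra h5
      exact h3 (t + 1) (by omega) (by omega) h5 (by omega)
    have h4 : s x (t - 1) = 0 := by
      by_contra h5
      exact h4 (t - 1) (by omega) (by omega) h5 (by omega)
    apply ht.2
    simp [waveField, h1, h2, h3, h4]
  have h1 := Finset.card_le_card hsub
  have h2 := Finset.card_union_le (F (x + 1) ∪ F (x - 1))
    ((F x).image (· - 1) ∪ (F x).image (· + 1))
  have h3 := Finset.card_union_le (F (x + 1)) (F (x - 1))
  have h4 := Finset.card_union_le ((F x).image (· - 1)) ((F x).image (· + 1))
  have h5 := Finset.card_image_le (s := F x) (f := (· - 1))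
  have h6 := Finset.card_image_le (s := F x) (f := (· + 1))
  have h7 : columnCount L (fun x t => waveField ω s x t ≠ 0) x
      = ((Finset.Ico 2 L).filter (fun t => waveField ω s x t ≠ 0)).card := by
    rw [columnCount]
    congr!
  rw [h7]
  have e : ∀ y, activity L s y = (F y).card := fun y => rfl
  rw [e, e, e]
  omega

/-- If the wave field vanishes on a column, then the `z`-bit has period two there, so that the
column is active half of the time. -/
theorem le_activity_of_waveField_eq_zero {K : Type*} [Field K] [Algebra (ZMod 2) K] {ω : K}
    (hω : ω ^ 2 + ω + 1 = 0) {s : ℤ → ℤ → ZMod 2 × ZMod 2} {n : ℕ} {x R : ℤ} (hR : 1 ≤ R)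
    (hL : 2 * R + 2 * n ≤ L) (hφ : ∀ t, R ≤ t → t ≤ L - R → waveField ω s x t = 0)
    {t₀ : ℤ} (h0 : R ≤ t₀) (h1 : t₀ ≤ L - R) (hz : (s x t₀).2 ≠ 0) : n ≤ activity L s x := by
  have hstep : ∀ t, R ≤ t → t ≤ L - R → (s x (t + 1)).2 = (s x (t - 1)).2 := by
    intro t h2 h3
    have h4 := hφ t h2 h3
    simp only [waveField, ← map_add] at h4
    have hbit : ∀ a : ZMod 2, a = 0 ∨ a = 1 := by decide
    have hsum : ∀ a b : ZMod 2, a + b = 0 → a = b := by decide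
    refine hsum _ _ ((hbit _).resolve_right fun h5 => ?_)
    rw [h5, map_one, mul_one] at h4
    rcases hbit ((s (x + 1) t).2 + (s (x - 1) t).2) with h6 | h6
    · rw [h6, map_zero, zero_add] at h4
      have h7 : ω = 0 := by simpa using h4
      rw [h7] at hω
      simp at hω
    · rw [h6, map_one] at h4
      have h7 : ω = 0 := by linear_combination hω - h4
      rw [h7] at hω
      simp at hω
  -- the class of times of the parity of `t₀` is active throughout
  set e := (t₀ - R) % 2 with he
  have he0 : 0 ≤ e := Int.emod_nonneg _ (by norm_num)
  have he1 : e < 2 := Int.emod_lt_of_pos _ (by norm_num)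
  have hconst : ∀ k : ℕ, R + e + 2 * k ≤ L - R → (s x (R + e + 2 * k)).2 = (s x (R + e)).2 := by
    intro k
    induction k with
    | zero => simp
    | succ k ih =>
      intro h2
      push_cast at h2 ⊢
      have h3 := hstep (R + e + 2 * k + 1) (by omega) (by omega)
      rw [add_sub_cancel_right, ih (by omega)] at h3
      rw [← h3]
      ring_nf
  have hne : (s x (R + e)).2 ≠ 0 := by
    have h2 := hconst ((t₀ - R) / 2).toNat
    have h3 : R + e + 2 * (((t₀ - R) / 2).toNat : ℤ) = t₀ := by omega
    rw [h3] at h2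
    rw [← h2 h1]
    exact hz
  rw [activity]
  calc n = (Finset.range n).card := (Finset.card_range n).symm
    _ ≤ _ := by
      refine Finset.card_le_card_of_injOn (fun k : ℕ => R + e + 2 * k) (fun k hk => ?_)
        fun a _ b _ hab => by simp only at hab; omega
      have hk' := Finset.mem_range.mp hk
      have h2 := hconst k (by omega)
      simp only [Finset.coe_filter, Finset.mem_Icc, Set.mem_ofPred_eq]
      exact ⟨⟨by omega, by omega⟩, fun h3 => hne (by rw [← h2, h3]; rfl)⟩

include h

theorem activity_periodic (x : ℤ) : activity L s (x + N) = activity L s x := by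
  simp only [activity, h.periodic]

/-- The total activity in a time window of length proportional to `N`, for sparse `D`, is at least
a large multiple of `N`. -/
theorem le_sum_activity (hper : ∀ x, D (x + N) ↔ D x) (r : ℕ) (hN : 0 < N) (hrN : 2 ^ r ≤ N)
    (hL : 2 * N + 2 * 16 ^ (r * 2 ^ r) + 20 ≤ L) (hD : ∀ S : Finset ℕ,
      (∀ x ∈ S, x < N ∧ D x) → (4 * 16 ^ (r * 2 ^ r) + 30) * S.card ≤ N) :
    2 ^ r * N ≤ 36 * ∑ x ∈ Finset.range N, activity L s x := by
  classical
  -- the field with four elements could be used, but any field containing it will do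
  let K := AlgebraicClosure (ZMod 2)
  have two : (2 : K) = 0 := by
    have : algebraMap (ZMod 2) K 2 = 0 := by rw [show (2 : ZMod 2) = 0 from rfl, map_zero]
    rwa [map_ofNat] at this
  obtain ⟨ω, hω⟩ : ∃ ω : K, ω ^ 2 + ω + 1 = 0 := by
    obtain ⟨ω, hω⟩ := IsAlgClosed.exists_root
      (Polynomial.X ^ 2 + Polynomial.X + 1 : Polynomial K) (by
        have : (Polynomial.X ^ 2 + Polynomial.X + 1 : Polynomial K).degree = 2 := by
          compute_degree!
        rw [this]; norm_num)
    exact ⟨ω, by simpa [Polynomial.IsRoot] using hω⟩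
  set φ := waveField ω s
  set p := 2 ^ r with hp
  set R : ℤ := 16 ^ (r * p) + 4 with hR
  have hR1 : (1 : ℤ) ≤ 16 ^ (r * p) := one_le_pow₀ (by norm_num)
  set S := columnCount L (fun x t => φ x t ≠ 0) with hS
  have hφper : ∀ x t, φ (x + N) t = φ x t := by
    intro x t
    simp only [φ, waveField, add_right_comm x (N : ℤ) 1, add_sub_right_comm x (N : ℤ) 1,
      h.periodic]
  have hSper : ∀ x, S (x + N) = S x := by
    intro x
    refine le_antisymm (columnCount_le_of_imp fun t _ _ ht => ?_)
      (columnCount_le_of_imp fun t _ _ ht => ?_)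
    · rwa [hφper] at ht
    · rwa [hφper]
  have hcper : ∀ x ρ, Clean D (x + N) ρ ↔ Clean D x ρ := by
    intro x ρ
    constructor
    · intro hc y hy hDy
      exact hc (y + N) (by simpa using hy) ((hper y).mpr hDy)
    · intro hc y hy hDy
      refine hc (y - N) (by rw [sub_sub, add_comm (N : ℤ)]; exact hy) ?_
      rw [← hper, sub_add_cancel]
      exact hDy
  set Act := ∑ x ∈ Finset.range N, activity L s x with hAct
  have hSsum : ∑ x ∈ Finset.range N, S x ≤ 4 * Act := by
    calc ∑ x ∈ Finset.range N, S x
        ≤ ∑ x ∈ Finset.range N, (activity L s (x + 1) + activity L s (x + -1)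
            + 2 * activity L s x) :=
          Finset.sum_le_sum fun x _ => columnCount_waveField_le ω s L x
      _ = 4 * Act := by
          rw [Finset.sum_add_distrib, Finset.sum_add_distrib,
            sum_range_periodic h.activity_periodic, sum_range_periodic h.activity_periodic,
            ← Finset.mul_sum]
          ring
  -- the columns far from `D` whose `z`-bit is not always zero
  let X : ℤ → Prop := fun x => Clean D x R ∧ ∃ t, R ≤ t ∧ t ≤ L - R ∧ (s x t).2 ≠ 0
  -- the columns on which the wave field is not identically zero
  let Y : ℤ → Prop := fun x => ∃ t, R ≤ t ∧ t ≤ L - R ∧ φ x t ≠ 0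
  have hX1 : 2 ^ r * ((Finset.range N).filter fun x : ℕ => X x ∧ Y x).card ≤ 8 * Act := by
    set B := (Finset.range N).filter fun x : ℕ => X x ∧ Y x with hB
    have h1 : ∑ x ∈ B, 4 ^ r * p ≤ ∑ x ∈ B, (∑ a ∈ Finset.range p, ∑ b : Fin r → Fin 2,
        S (x + shift spaceStep (16 ^ (r * a)) b) + 4 ^ r * S x) := by
      refine Finset.sum_le_sum fun x hx => ?_
      obtain ⟨-, ⟨hc, -⟩, t, h2, h3, h4⟩ := Finset.mem_filter.mp hx
      exact (h.wave hω two).le_sum_columnCount two hω r p (hc.shift (by simp; omega))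
        (by omega) (by omega) h4
    have h2 : ∑ x ∈ B, (∑ a ∈ Finset.range p, ∑ b : Fin r → Fin 2,
        S (x + shift spaceStep (16 ^ (r * a)) b) + 4 ^ r * S x)
        ≤ (p * 2 ^ r + 4 ^ r) * ∑ x ∈ Finset.range N, S x := by
      calc _ ≤ ∑ x ∈ Finset.range N, (∑ a ∈ Finset.range p, ∑ b : Fin r → Fin 2,
            S (x + shift spaceStep (16 ^ (r * a)) b) + 4 ^ r * S x) :=
            Finset.sum_le_sum_of_subset (Finset.filter_subset _ _)
        _ = ∑ a ∈ Finset.range p, ∑ b : Fin r → Fin 2, ∑ x ∈ Finset.range N,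
              S (x + shift spaceStep (16 ^ (r * a)) b)
            + 4 ^ r * ∑ x ∈ Finset.range N, S x := by
            rw [Finset.sum_add_distrib, ← Finset.mul_sum, Finset.sum_comm]
            congr 1
            exact Finset.sum_congr rfl fun a _ => Finset.sum_comm
        _ = _ := by
            simp only [sum_range_periodic hSper, Finset.sum_const, Finset.card_range,
              Finset.card_univ, smul_eq_mul, Fintype.card_fun, Fintype.card_fin]
            ring
    rw [Finset.sum_const, smul_eq_mul] at h1
    have h3 := h1.trans h2
    have h4 : (4 : ℕ) ^ r = 2 ^ r * 2 ^ r := by rw [← mul_pow]; norm_num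
    rw [h4, hp] at h3
    have h5 : 0 < 2 ^ r * 2 ^ r := by positivity
    refine le_of_mul_le_mul_left ?_ h5
    calc 2 ^ r * 2 ^ r * (2 ^ r * B.card) = B.card * (2 ^ r * 2 ^ r * 2 ^ r) := by ring
      _ ≤ (2 ^ r * 2 ^ r + 2 ^ r * 2 ^ r) * ∑ x ∈ Finset.range N, S x := h3
      _ ≤ (2 ^ r * 2 ^ r + 2 ^ r * 2 ^ r) * (4 * Act) := by gcongr
      _ = _ := by ring
  have hX2 : 2 ^ r * ((Finset.range N).filter fun x : ℕ => X x ∧ ¬Y x).card ≤ Act := by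
    calc 2 ^ r * ((Finset.range N).filter fun x : ℕ => X x ∧ ¬Y x).card
        = ∑ x ∈ (Finset.range N).filter fun x : ℕ => X x ∧ ¬Y x, 2 ^ r := by
          rw [Finset.sum_const, smul_eq_mul, mul_comm]
      _ ≤ ∑ x ∈ (Finset.range N).filter fun x : ℕ => X x ∧ ¬Y x, activity L s x := by
          refine Finset.sum_le_sum fun x hx => hrN.trans ?_
          obtain ⟨-, ⟨-, t, h2, h3, h4⟩, hY⟩ := Finset.mem_filter.mp hx
          refine le_activity_of_waveField_eq_zero hω (R := R) (by omega) (by omega)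
            (fun t h5 h6 => ?_) h2 h3 h4
          by_contra h7
          exact hY ⟨t, h5, h6, h7⟩
      _ ≤ Act := Finset.sum_le_sum_of_subset (Finset.filter_subset _ _)
  have hX : 2 ^ r * ((Finset.range N).filter fun x : ℕ => X x).card ≤ 9 * Act := by
    have h1 := Finset.card_filter_add_card_filter_not (s := (Finset.range N).filter fun x : ℕ => X x)
      (fun x : ℕ => Y x)
    rw [Finset.filter_filter, Finset.filter_filter] at h1
    rw [← h1, mul_add]
    omega
  have hXper : ∀ x, X (x + N) ↔ X x := by
    intro x
    simp only [X, hcper, h.periodic]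
  have hgood : ((Finset.range N).filter fun x : ℕ => Clean D x (R + 1)).card
      ≤ 2 * ((Finset.range N).filter fun x : ℕ => X x).card := by
    have h1 := sum_range_periodic (N := N) (f := fun x => if X x then 1 else 0)
      (fun x => by simp only [hXper]) 1
    rw [Finset.card_filter, Finset.card_filter, two_mul]
    nth_rewrite 2 [← h1]
    rw [← Finset.sum_add_distrib]
    refine Finset.sum_le_sum fun x _ => ?_
    by_cases hc : Clean D x (R + 1)
    · obtain ⟨t, h2, h3, h4⟩ := h.exists_snd_ne_zero hN (x := x) (hc.shift (by simp; omega))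
        (a := R) (b := L - R) (by omega) (by omega) (by omega)
      rcases h4 with h4 | h4
      · have : X x := ⟨hc.shift (by simp), t, h2, h3, h4⟩
        simp [hc, this]
      · have : X (x + 1) := ⟨hc.shift (by simp; omega), t, h2, h3, h4⟩
        simp [hc, this]
    · simp [hc]
  have hbad : N ≤ 2 * ((Finset.range N).filter fun x : ℕ => Clean D x (R + 1)).card := by
    have h1 := Finset.card_filter_add_card_filter_not (s := Finset.range N)
      (fun x : ℕ => Clean D x (R + 1))
    rw [Finset.card_range] at h1
    have h2 : ((Finset.range N).filter fun x : ℕ => ¬Clean D x (R + 1)).card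
        ≤ (Finset.Icc (-(R + 1)) (R + 1)).card
          * ((Finset.range N).filter fun x : ℕ => D x).card := by
      calc _ ≤ ∑ x ∈ Finset.range N, ∑ d ∈ Finset.Icc (-(R + 1)) (R + 1),
            (if D (x + d) then 1 else 0) := by
            rw [Finset.card_filter]
            refine Finset.sum_le_sum fun x _ => ?_
            by_cases hc : Clean D x (R + 1)
            · simp [hc]
            · rw [if_pos hc]
              simp only [Clean, not_forall, not_not] at hc
              obtain ⟨y, hy, hDy⟩ := hc
              have hy' := abs_le.mp hy
              refine le_trans ?_ (Finset.single_le_sum (f := fun d : ℤ =>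
                if D (x + d) then 1 else 0) (fun _ _ => Nat.zero_le _)
                (Finset.mem_Icc.mpr hy'))
              simp [hDy]
        _ = ∑ d ∈ Finset.Icc (-(R + 1)) (R + 1), ((Finset.range N).filter
              fun x : ℕ => D x).card := by
            rw [Finset.sum_comm]
            refine Finset.sum_congr rfl fun d _ => ?_
            rw [sum_range_periodic (f := fun x => if D x then 1 else 0)
              (fun x => by simp only [hper]), Finset.card_filter]
        _ = _ := by rw [Finset.sum_const, smul_eq_mul]
    have h3 := hD ((Finset.range N).filter fun x : ℕ => D x) (fun x hx => by
      simpa using hx)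
    have h4 : (Finset.Icc (-(R + 1)) (R + 1)).card = 2 * 16 ^ (r * p) + 11 := by
      rw [Int.card_Icc, hR]
      have : (R + 1 + 1 - -(R + 1)) = ((2 * 16 ^ (r * p) + 11 : ℕ) : ℤ) := by
        rw [hR]; push_cast; ring
      rw [hR] at this
      rw [this, Int.toNat_natCast]
    rw [h4] at h2
    nlinarith
  calc 2 ^ r * N ≤ 2 ^ r * (2 * (2 * ((Finset.range N).filter fun x : ℕ => X x).card)) := by
        gcongr; omega
    _ = 4 * (2 ^ r * ((Finset.range N).filter fun x : ℕ => X x).card) := by ring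
    _ ≤ 36 * Act := by omega

end IsHistory

/-! ### From trajectories to space-time patterns -/

/-- The site of the ring covered by a site of the unrolled ring. -/
def site {N : ℕ} (hN : 0 < N) (x : ℤ) : Fin N :=
  ⟨(x % N).toNat, by have := Int.emod_lt_of_pos x (by omega : (0 : ℤ) < N); omega⟩

section Site

variable {N : ℕ} (hN : 0 < N)

theorem site_val (x : ℤ) : ((site hN x).val : ℤ) = x % N :=
  Int.toNat_of_nonneg (Int.emod_nonneg _ (by omega))

theorem site_add (x : ℤ) : site hN (x + N) = site hN x := by
  simp [site]

theorem site_natCast {n : ℕ} (hn : n < N) : site hN n = ⟨n, hn⟩ := by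
  ext
  zify
  rw [site_val]
  exact Int.emod_eq_of_lt (by omega) (by omega)

theorem site_succ (x : ℤ) : site hN (x + 1) = finRotate N (site hN x) := by
  obtain _ | n := N
  · omega
  ext
  have h1 := site_val hN x
  have h2 := site_val hN (x + 1)
  have h3 : (x + 1) % ((n + 1 : ℕ) : ℤ) = (x % ((n + 1 : ℕ) : ℤ) + 1) % ((n + 1 : ℕ) : ℤ) := by
    rw [Int.emod_add_emod]
  have h4 := (site hN x).isLt
  rw [coe_finRotate]
  zify
  rw [h2, h3, ← h1]
  split_ifs with h5
  · rw [h5, Fin.val_last]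
    push_cast
    exact Int.emod_self
  · have h6 : (site hN x).val ≠ n := fun h => h5 (Fin.ext h)
    push_cast
    exact Int.emod_eq_of_lt (by omega) (by omega)

theorem site_val_mod_two (hev : Even N) (x : ℤ) : ((site hN x).val : ℤ) % 2 = x % 2 := by
  obtain ⟨k, hk⟩ := hev
  rw [site_val]
  exact Int.emod_emod_of_dvd x ⟨k, by omega⟩

theorem card_filter_site (P : Fin N → Prop) [DecidablePred P] :
    ((Finset.range N).filter fun x : ℕ => P (site hN x)).card = (Finset.univ.filter P).card := by
  rw [Finset.card_filter, Finset.card_filter, ← Fin.sum_univ_eq_sum_range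
    (fun x : ℕ => if P (site hN x) then 1 else 0)]
  refine Finset.sum_congr rfl fun i _ => ?_
  rw [site_natCast hN i.isLt]

end Site

theorem HalfStep.bits_spec {N : ℕ} {D : Finset (Fin N)} {p : ℕ} {μ ν : Fin N → Fin 4}
    (h : HalfStep D p μ ν) {i : Fin N} (hi : i.val % 2 = p) :
    (bits (ν i) = 0 ↔ outL (bits (μ i)) (bits (μ (finRotate N i))) = 0) ∧
    (bits (ν (finRotate N i)) = 0 ↔ outR (bits (μ i)) (bits (μ (finRotate N i))) = 0) ∧
    (i ∉ D → bits (ν i) = outL (bits (μ i)) (bits (μ (finRotate N i)))) ∧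
    (finRotate N i ∉ D →
      bits (ν (finRotate N i)) = outR (bits (μ i)) (bits (μ (finRotate N i)))) := by
  obtain ⟨α, hb, h0, hD⟩ := h
  obtain ⟨h1, h2⟩ := hb i hi
  rw [← h1, ← h2]
  simp only [bits_eq_zero, h0, true_and]
  exact ⟨fun hi => by rw [hD _ hi], fun hi => by rw [hD _ hi]⟩

theorem weight_eq_zero {N : ℕ} {μ : Fin N → Fin 4} : DHFC.weight μ = 0 ↔ μ = 0 := by
  simp [DHFC.weight, Finset.filter_eq_empty_iff, funext_iff]

/-- The string at time `t` of a backward path of `T` periods, run forward through its `2 * T`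
brickwork layers. -/
def pathString {N : ℕ} (b mid : ℕ → Fin N → Fin 4) (T : ℕ) (t : ℤ) : Fin N → Fin 4 :=
  if t % 2 = 0 then b (T - t / 2).toNat else mid (T - t / 2 - 1).toNat

section Path

variable {N : ℕ} (hN : 0 < N) (hev : Even N) {D : Finset (Fin N)}
  {b mid : ℕ → Fin N → Fin 4} (hb : ∀ n, b n ≠ 0)
  (h0 : ∀ n, HalfStep D 0 (b (n + 1)) (mid n)) (h1 : ∀ n, HalfStep D 1 (mid n) (b n))
include hev hb h0 h1

theorem isHistory_path (T : ℕ) : IsHistory N (2 * T) (fun x => site hN x ∈ D)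
    (fun x t => bits (pathString b mid T t (site hN x))) := by
  have hstep : ∀ t : ℤ, 0 ≤ t → t < 2 * T →
      HalfStep D (t % 2).toNat (pathString b mid T t) (pathString b mid T (t + 1)) := by
    intro t ht0 htT
    rcases Int.emod_two_eq_zero_or_one t with ht | ht
    · have e1 : (T - t / 2).toNat = (T - (t + 1) / 2 - 1).toNat + 1 := by omega
      rw [pathString, pathString, if_pos ht, if_neg (by omega), ht, e1]
      exact h0 _
    · have e1 : (T - t / 2 - 1).toNat = (T - (t + 1) / 2).toNat := by omega
      rw [pathString, pathString, if_neg (by omega), if_pos (by omega), ht, e1]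
      exact h1 _
  have hspec := fun (x t : ℤ) (ht0 : 0 ≤ t) (htT : t < 2 * T) (hx : 2 ∣ x - t) =>
    (hstep t ht0 htT).bits_spec (i := site hN x) (by
      have := site_val_mod_two hN hev x
      omega)
  simp only [← site_succ] at hspec
  refine ⟨fun x t => by rw [site_add], fun x t a b c => (hspec x t a b c).1,
    fun x t a b c => (hspec x t a b c).2.1, fun x t a b c => (hspec x t a b c).2.2.1,
    fun x t a b c => (hspec x t a b c).2.2.2, fun t _ _ => ?_⟩
  have hmid : ∀ n, mid n ≠ 0 := by
    intro n hn
    have h2 := (h0 n).weight_le hev (by norm_num)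
    rw [hn, weight_eq_zero.mpr rfl] at h2
    exact hb (n + 1) (weight_eq_zero.mp (by omega))
  have hne : pathString b mid T t ≠ 0 := by
    rw [pathString]
    split_ifs
    · exact hb _
    · exact hmid _
  obtain ⟨i, hi⟩ := Function.ne_iff.mp hne
  refine ⟨(i.val : ℤ), fun h2 => hi ?_⟩
  rw [site_natCast hN i.isLt] at h2
  exact bits_eq_zero.mp h2

omit hb h0 in
/-- The weight in the middle of a period is at most twice the weight at its end. -/
theorem sum_activity_path_le (T : ℕ) :
    ∑ x ∈ Finset.range N, activity (2 * T) (fun x t => bits (pathString b mid T t (site hN x))) x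
      ≤ 3 * ∑ n ∈ Finset.range T, DHFC.weight (b n) := by
  have e1 : ∑ x ∈ Finset.range N,
      activity (2 * T) (fun x t => bits (pathString b mid T t (site hN x))) x
      = ∑ t ∈ Finset.Icc (1 : ℤ) (2 * T), DHFC.weight (pathString b mid T t) := by
    simp only [activity, Finset.card_filter]
    rw [Finset.sum_comm]
    refine Finset.sum_congr rfl fun t _ => ?_
    rw [← Finset.card_filter, card_filter_site hN fun i => bits (pathString b mid T t i) ≠ 0,
      DHFC.weight]
    simp only [ne_eq, bits_eq_zero]
  have e2 : ∀ (f : ℤ → ℕ) (T : ℕ), ∑ t ∈ Finset.Icc (1 : ℤ) (2 * T), f t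
      = ∑ k ∈ Finset.range T, (f (2 * k + 1) + f (2 * k + 2)) := by
    intro f T
    induction T with
    | zero => simp
    | succ T ih =>
      rw [Finset.sum_range_succ, ← ih]
      have e3 : (Finset.Icc 1 (2 * (T + 1 : ℕ)) : Finset ℤ)
          = insert (2 * (T : ℤ) + 2) (insert (2 * (T : ℤ) + 1) (Finset.Icc (1 : ℤ) (2 * T))) := by
        ext t
        simp only [Finset.mem_Icc, Finset.mem_insert]
        omega
      rw [e3, Finset.sum_insert (by simp), Finset.sum_insert (by simp)]
      ring
  rw [e1, e2, Finset.mul_sum, ← Finset.sum_range_reflect (fun n => 3 * DHFC.weight (b n))]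
  refine Finset.sum_le_sum fun k hk => ?_
  have hk' := Finset.mem_range.mp hk
  have e3 : pathString b mid T (2 * k + 1) = mid (T - 1 - k) := by
    rw [pathString, if_neg (by omega)]
    congr 1
    omega
  have e4 : pathString b mid T (2 * k + 2) = b (T - 1 - k) := by
    rw [pathString, if_pos (by omega)]
    congr 1
    omega
  have h2 := (h1 (T - 1 - k)).weight_le hev (by norm_num)
  rw [e3, e4]
  omega

/-- A trajectory of Pauli strings through a sparsely doped circuit has a large average weight. -/
theorem le_sum_weight (r : ℕ) (hlarge : 16 ^ (r * 2 ^ r) + 2 ^ r + 10 ≤ N)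
    (hD : (4 * 16 ^ (r * 2 ^ r) + 30) * D.card ≤ N) :
    2 ^ r * N ≤ 108 * ∑ n ∈ Finset.range (2 * N), DHFC.weight (b n) := by
  have hN : 0 < N := lt_of_lt_of_le (by positivity) hlarge
  have h2 := (isHistory_path hN hev hb h0 h1 (2 * N)).le_sum_activity
    (fun x => by rw [site_add]) r hN
    ((Nat.le_add_left _ _).trans ((Nat.le_add_right _ 10).trans hlarge)) (by
      have : ((16 ^ (r * 2 ^ r) + 2 ^ r + 10 : ℕ) : ℤ) ≤ N := by exact_mod_cast hlarge
      push_cast at this ⊢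
      have h3 : (0 : ℤ) ≤ 2 ^ r := by positivity
      linarith) (fun S hS => ?_)
  · have h3 := sum_activity_path_le hN hev h1 (2 * N)
    omega
  · refine le_trans (Nat.mul_le_mul_left _ ?_) hD
    refine Finset.card_le_card_of_injOn (fun x : ℕ => site hN x) (fun x hx => (hS x hx).2) ?_
    intro x hx y hy hxy
    simp only [site_natCast hN (hS x hx).1, site_natCast hN (hS y hy).1, Fin.mk.injEq] at hxy
    exact hxy

end Path

/-! ### The Liouvillian gap -/

/-- Pauli strings span all operators, as product operators are combinations of them. -/
theorem eq_zero_of_coeff_eq_zero {N : ℕ} {ρ : DHFC.Op N} (h : ∀ ν, coeff ν ρ = 0) : ρ = 0 := by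
  have hA : ∀ A : Fin N → Matrix (Fin 2) (Fin 2) ℂ, (DHFC.siteProd A * ρ).trace = 0 := by
    intro A
    have h1 : DHFC.siteProd A = ∑ α : Fin N → Fin 4,
        (∏ j, (DHFC.pauli (α j) * A j).trace / 2) • DHFC.pauliString α := by
      rw [← siteProd_sum_smul fun j a => (DHFC.pauli a * A j).trace / 2]
      congr 1
      funext j
      exact eq_sum_pauli _
    rw [h1, Finset.sum_mul, Matrix.trace_sum]
    refine Finset.sum_eq_zero fun α _ => ?_
    have h2 := h α
    rw [coeff] at h2
    rw [Matrix.smul_mul, Matrix.trace_smul, h2, smul_zero]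
  ext y x
  -- the matrix unit at `(x, y)` is a product operator
  have h1 := hA fun j => Matrix.single (x j) (y j) 1
  have h2 : DHFC.siteProd (fun j => Matrix.single (x j) (y j) (1 : ℂ)) = Matrix.single x y 1 := by
    ext u v
    simp only [DHFC.siteProd, Matrix.of_apply, Matrix.single_apply, Finset.prod_ite_zero,
      Finset.prod_const_one, Finset.mem_univ, forall_true_left, funext_iff, forall_and]
  rw [h2, Matrix.trace_single_mul, one_smul] at h1
  exact h1

section Gap

variable {N : ℕ} (hev : Even N) (C : DHFC.Circuit N) {γ : ℝ}
include hev

theorem floquet_injective {ρ : DHFC.Op N} (h : C.floquet γ ρ = 0) : ρ = 0 := by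
  have h1 : DHFC.conjChannel C.periodUnitary ρ = 0 := by
    refine eq_zero_of_coeff_eq_zero fun ν => ?_
    have h2 := coeff_noise γ ν (DHFC.conjChannel C.periodUnitary ρ)
    rw [← LinearMap.comp_apply, ← DHFC.Circuit.floquet, h, coeff, mul_zero, Matrix.trace_zero,
      eq_comm, mul_eq_zero] at h2
    exact h2.resolve_left (by exact_mod_cast (Real.exp_pos _).ne')
  have hU := periodUnitary_conjTranspose_mul hev C
  calc ρ = (C.periodUnitary.conjTranspose * C.periodUnitary) * ρ
        * (C.periodUnitary.conjTranspose * C.periodUnitary) := by rw [hU, one_mul, mul_one]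
    _ = C.periodUnitary.conjTranspose * DHFC.conjChannel C.periodUnitary ρ
        * C.periodUnitary := by simp [DHFC.conjChannel, mul_assoc]
    _ = 0 := by rw [h1, mul_zero, zero_mul]

/-- An eigenvalue with a traceless eigenvector exists, as the channel preserves the trace. -/
theorem exists_traceless_eigenvector (hN : 0 < N) (γ : ℝ) :
    ∃ (lam : ℂ) (ρ : DHFC.Op N), lam ≠ 0 ∧ ρ ≠ 0 ∧ C.floquet γ ρ = lam • ρ ∧ coeff 0 ρ = 0 := by
  let f : DHFC.Op N →ₗ[ℂ] ℂ :=
    { toFun := coeff 0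
      map_add' := fun a b => by simp [coeff, mul_add]
      map_smul' := fun c a => by simp [coeff] }
  have hmap : ∀ ρ ∈ LinearMap.ker f, C.floquet γ ρ ∈ LinearMap.ker f := by
    intro ρ hρ
    exact (trace_floquet hev C γ ρ).trans hρ
  have hX : DHFC.pauliString (fun _ : Fin N => (1 : Fin 4)) ∈ LinearMap.ker f := by
    change coeff 0 _ = 0
    rw [coeff, DHFC.pauliString_trace_mul, if_neg]
    intro h
    exact absurd (congrFun h ⟨0, hN⟩) (by simp)
  have hX0 : DHFC.pauliString (fun _ : Fin N => (1 : Fin 4)) ≠ 0 := by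
    intro h
    have h1 := DHFC.pauliString_trace_mul (fun _ : Fin N => (1 : Fin 4)) fun _ => 1
    rw [h, mul_zero, Matrix.trace_zero, if_pos rfl] at h1
    exact pow_ne_zero N two_ne_zero h1.symm
  have : Nontrivial (LinearMap.ker f) :=
    ⟨⟨_, hX⟩, 0, fun h => hX0 (congrArg Subtype.val h)⟩
  obtain ⟨lam, hlam⟩ := Module.End.exists_eigenvalue ((C.floquet γ).restrict hmap)
  obtain ⟨v, hv⟩ := hlam.exists_hasEigenvector
  have h1 : C.floquet γ v.1 = lam • v.1 := congrArg Subtype.val hv.apply_eq_smul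
  have h2 : v.1 ≠ 0 := fun h => hv.2 (Subtype.ext h)
  refine ⟨lam, v.1, fun h => h2 (floquet_injective hev C (γ := γ) ?_), h2, h1, v.2⟩
  rw [h1, h, zero_smul]

/-- One window of `2 * N` periods suffices: as the path starts at the largest coefficient of the
eigenvector, the total weight over the window bounds `‖lam‖ ^ (2 * N)`. -/
theorem log_norm_eigenvalue_le (hγ : 5 ≤ γ) (r : ℕ)
    (hlarge : 16 ^ (r * 2 ^ r) + 2 ^ r + 10 ≤ N)
    (hD : (4 * 16 ^ (r * 2 ^ r) + 30) * C.numDoped ≤ N) {lam : ℂ} {ρ : DHFC.Op N}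
    (hρ : C.floquet γ ρ = lam • ρ) (hlam : lam ≠ 0) (h : ρ ≠ 0) (htr : coeff 0 ρ = 0) :
    Real.log ‖lam‖ ≤ -(2 ^ r / 216) := by
  have hN : 0 < N := lt_of_lt_of_le (by positivity) hlarge
  obtain ⟨b, mid, hb, h0, h1, hle⟩ := exists_backward_path hev C hρ hlam h htr
  have hw := le_sum_weight hev hb h0 h1 r hlarge hD
  have hw' : (2 : ℝ) ^ r * N ≤ 108 * ∑ n ∈ Finset.range (2 * N), (DHFC.weight (b n) : ℝ) := by
    exact_mod_cast hw
  have h2 := Real.log_le_log (pow_pos (norm_pos_iff.mpr hlam) _) (hle (2 * N))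
  rw [Real.log_pow, Real.log_exp] at h2
  push_cast at h2
  set W := ∑ n ∈ Finset.range (2 * N), (DHFC.weight (b n) : ℝ)
  have hW : 0 ≤ W := Finset.sum_nonneg fun n _ => Nat.cast_nonneg _
  have hNpos : (0 : ℝ) < N := by exact_mod_cast hN
  have h3 : -(γ - 4) * W ≤ -W := by nlinarith
  have h4 : N * (Real.log ‖lam‖ + 2 ^ r / 216) ≤ 0 := by linarith
  by_contra! hcon
  nlinarith [mul_pos hNpos (by linarith : 0 < Real.log ‖lam‖ + 2 ^ r / 216)]

/-- The gap is a negated supremum, which needs a nontrivial eigenvalue to exist, as the supremum of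
the empty set is zero by convention. -/
theorem le_gap (hγ : 5 ≤ γ) (r : ℕ) (hlarge : 16 ^ (r * 2 ^ r) + 2 ^ r + 10 ≤ N)
    (hD : (4 * 16 ^ (r * 2 ^ r) + 30) * C.numDoped ≤ N) : 2 ^ r / 216 ≤ C.gap γ := by
  have hpos : (0 : ℝ) < 2 ^ r / 216 := by positivity
  rw [DHFC.Circuit.gap, le_neg]
  refine csSup_le ?_ ?_
  · obtain ⟨lam, ρ, hlam, h, hρ, htr⟩ := exists_traceless_eigenvector hev C
      (lt_of_lt_of_le (by positivity) hlarge) γ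
    refine ⟨_, Complex.log lam, ?_, ?_, rfl⟩
    · rw [Complex.exp_log hlam]
      exact Module.End.hasEigenvalue_of_hasEigenvector
        ⟨Module.End.mem_eigenspace_iff.mpr hρ, h⟩
    · rw [Complex.exp_log hlam]
      rintro rfl
      have := log_norm_eigenvalue_le hev C hγ r hlarge hD hρ hlam h htr
      simp at this
      linarith
  · rintro x ⟨z, hz, hz1, rfl⟩
    obtain ⟨ρ, hρ⟩ := hz.exists_hasEigenvector
    have h1 := hρ.apply_eq_smul
    have htr : coeff 0 ρ = 0 := by
      have h2 := trace_floquet hev C γ ρ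
      rw [h1, coeff, Matrix.mul_smul, Matrix.trace_smul, smul_eq_mul, ← coeff] at h2
      have h3 : (Complex.exp z - 1) * coeff 0 ρ = 0 := by rw [sub_mul, h2, one_mul, sub_self]
      exact (mul_eq_zero.mp h3).resolve_left (sub_ne_zero.mpr hz1)
    have h2 := log_norm_eigenvalue_le hev C hγ r hlarge hD h1 (Complex.exp_ne_zero z) hρ.2 htr
    rwa [Complex.norm_exp, Real.log_exp] at h2

end Gap

/-- Below a positive doping rate depending only on `G`, the gap of a large circuit exceeds `G`. -/
theorem exists_rate_le_gap (G : ℝ) : ∃ ε : ℝ, 0 < ε ∧ ∃ N₀ : ℕ, ∀ N, N₀ ≤ N → Even N →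
    ∀ (C : DHFC.Circuit N) (γ : ℝ), 5 ≤ γ → (C.numDoped : ℝ) ≤ ε * N → G ≤ C.gap γ := by
  obtain ⟨r, hr⟩ := pow_unbounded_of_one_lt (216 * G) (one_lt_two : (1 : ℝ) < 2)
  have hM : (0 : ℝ) < 4 * 16 ^ (r * 2 ^ r) + 30 := by positivity
  refine ⟨(4 * 16 ^ (r * 2 ^ r) + 30)⁻¹, inv_pos.mpr hM, 16 ^ (r * 2 ^ r) + 2 ^ r + 10,
    fun N hN hev C γ hγ hC => ?_⟩
  refine le_trans (by linarith) (le_gap hev C hγ r hN ?_)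
  rw [inv_mul_eq_div, le_div_iff₀ hM, mul_comm] at hC
  exact_mod_cast hC

theorem mainTheorem2 :
    ∃ γ₀ : ℝ, 0 < γ₀ ∧ ∀ γ : ℝ, γ₀ ≤ γ →
      ∀ (N : ℕ → ℕ), (∀ k, Even (N k)) → Tendsto N atTop atTop →
      ∀ C : (k : ℕ) → DHFC.Circuit (N k),
        ((fun k => ((C k).numDoped : ℝ)) =o[atTop] (fun k => (N k : ℝ)) →
          Tendsto (fun k => (C k).gap γ) atTop atTop) ∧
        (IsBoundedUnder (· ≤ ·) atTop (fun k => (C k).gap γ) →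
          (fun k => ((C k).numDoped : ℝ)) =Θ[atTop] (fun k => (N k : ℝ))) := by
  refine ⟨5, by norm_num, fun γ hγ N hev hN C => ⟨fun ho => ?_, fun hbdd => ?_⟩⟩
  · refine tendsto_atTop.mpr fun G => ?_
    obtain ⟨ε, hε, N₀, hG⟩ := exists_rate_le_gap G
    filter_upwards [hN.eventually_ge_atTop N₀, ho.def hε] with k h1 h2
    exact hG (N k) h1 (hev k) (C k) γ hγ (by simpa using h2)
  · obtain ⟨B, hB⟩ := hbdd
    rw [eventually_map] at hB
    obtain ⟨ε, hε, N₀, hG⟩ := exists_rate_le_gap (B + 1)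
    constructor
    · refine IsBigO.of_bound 1 (Eventually.of_forall fun k => ?_)
      have h1 : (C k).numDoped ≤ N k := by
        simpa [DHFC.Circuit.numDoped] using (C k).doped.card_le_univ
      simpa using h1
    · refine IsBigO.of_bound ε⁻¹ ?_
      filter_upwards [hN.eventually_ge_atTop N₀, hB] with k h1 h2
      have h3 : ε * N k < (C k).numDoped := by
        by_contra! hcon
        have := hG (N k) h1 (hev k) (C k) γ hγ hcon
        linarith
      rw [Real.norm_natCast, Real.norm_natCast, inv_mul_eq_div, le_div_iff₀ hε, mul_comm]
      exact h3.le
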